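/- Let $k$ be an algebraically closed field of characteristic $0$ and $S=k[x,y,z,w]$ with the standard grading. Put $$I=(x,y)^3+(z,w)^3+(xz-yw),\qquad J=(x,y)^3+(z,w)^3+(xz-yw,\;x^2z^2,\;x^2w^2,\;y^2z^2),$$ $A=S/I$ and $B=S/J$. Then $A$ and $B$ are local Artinian rings, and, writing $\operatorname{Soc}$ for the ideal of elements killed by the maximal ideal: 1. $\operatorname{Soc}A$ is generated by the classes of $x^2z^2,\ x^2zw,\ x^2w^2,\ xyz^2,\ y^2z^2$, and $\dim_k\operatorname{Soc}A=5$. 2. $\operatorname{Soc}B$ is generated by the classes of $x^2zw$ and $xyz^2$, and $\dim_k\operatorname{Soc}B=2$. 3. $B$ has trivial negative tangents, i.e. $T^1(B/k,B)_j=0$ for all $j<0$. 4. $B$ has vanishing nonnegative obstruction space, i.e. $T^2(B/k,B)_j=0$ for all $j\ge 0$. Here $T^i(B/k,B)=H^i(\operatorname{Hom}_B(L_\bullet,B))$ with its $\mathbb Z$-grading, where $L_\bullet$ is the truncated cotangent complex $\Omega_{S/k}\otimes_S B\leftarrow F\otimes_S B\leftarrow Q/\mathrm{Kos}$ of $k\to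 B$. It is built from a graded surjection $p\colon F\to J$ with $F$ a finite graded free $S$-module: $Q=\ker p$, $\mathrm{Kos}\subseteq Q$ is the submodule generated by the Koszul relations $p(a)b-p(b)a$ for $a,b\in F$, the first map is induced by $e\mapsto d(p(e))$, and the second by the inclusion $Q\subseteq F$. Statements 3 and 4 hold for every choice of $F$ and $p$. -/

import Mathlib

open scoped TensorProduct

noncomputable section

namespace SmallElementary

/-- Homogeneous generators of an ideal `I` of an `A`-algebra `R` with homogeneous parts `𝓡 m`. This
is a graded surjection `F → I` from the graded free `R`-module `F = ι → R` whose basis vector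
`e i` has degree `deg i`, with `e i ↦ gen i`. The modules `T1` and `T2` below are those of
`A → R / I` when `R` is a polynomial ring over `A`, which is the case they are meant for. -/
structure HomogeneousGenerators {A R : Type*} [CommRing A] [CommRing R] [Algebra A R]
    (𝓡 : ℤ → Submodule A R) (I : Ideal R) (ι : Type*) where
  gen : ι → R
  deg : ι → ℤ
  gen_mem : ∀ i, gen i ∈ 𝓡 (deg i)
  span_range_gen : Ideal.span (Set.range gen) = I

/-- The degree `m` part of `R / I`, as the image of the degree `m` part of `R`. -/
def quotientPiece {A R : Type*} [CommRing A] [CommRing R] [Algebra A R]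
    (𝓡 : ℤ → Submodule A R) (I : Ideal R) (m : ℤ) : Submodule A (R ⧸ I) :=
  (𝓡 m).map (Ideal.Quotient.mkₐ A I).toLinearMap

/-- The `R`-linear maps `L → M` that are homogeneous of degree `j`: they send `L_m` into
`M_{m + j}` for all `m`. -/
def homPiece {A R L M : Type*} [CommRing A] [CommRing R] [Algebra A R]
    [AddCommGroup L] [Module R L] [Module A L]
    [AddCommGroup M] [Module R M] [Module A M] [IsScalarTower A R M]
    (𝓛 : ℤ → Submodule A L) (𝓜 : ℤ → Submodule A M) (j : ℤ) : Submodule A (L →ₗ[R] M) where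
  carrier := {φ | ∀ m, ∀ x ∈ 𝓛 m, φ x ∈ 𝓜 (m + j)}
  add_mem' hφ hψ m x hx := (𝓜 (m + j)).add_mem (hφ m x hx) (hψ m x hx)
  zero_mem' m _ _ := (𝓜 (m + j)).zero_mem
  smul_mem' c _ hφ m x hx := (𝓜 (m + j)).smul_mem c (hφ m x hx)

/-- The cohomology `ker g / im f` of a complex `M → N → P`. -/
abbrev Cohomology {R M N P : Type*} [CommRing R] [AddCommGroup M] [Module R M]
    [AddCommGroup N] [Module R N] [AddCommGroup P] [Module R P]
    (f : M →ₗ[R] N) (g : N →ₗ[R] P) : Type _ :=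
  LinearMap.ker g ⧸ (LinearMap.range f).submoduleOf (LinearMap.ker g)

/-- The classes in `ker g / im f` of the cocycles that lie in the `A`-submodule `S` of `N`. -/
def cohomologyClasses {A R M N P : Type*} [CommRing A] [CommRing R] [Algebra A R]
    [AddCommGroup M] [Module R M] [AddCommGroup N] [Module R N] [Module A N] [IsScalarTower A R N]
    [AddCommGroup P] [Module R P] (f : M →ₗ[R] N) (g : N →ₗ[R] P) (S : Submodule A N) :
    Submodule A (Cohomology f g) :=
  (S.comap ((LinearMap.ker g).subtype.restrictScalars A)).map
    (((LinearMap.range f).submoduleOf (LinearMap.ker g)).mkQ.restrictScalars A)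

namespace HomogeneousGenerators

variable {A R ι : Type*} [CommRing A] [CommRing R] [Algebra A R] [Fintype ι]
  {𝓡 : ℤ → Submodule A R} {I : Ideal R} (P : HomogeneousGenerators 𝓡 I ι)

/-- The surjection `F → I`, written as a map `F → R` with image `I`. -/
def toIdeal : (ι → R) →ₗ[R] R :=
  Fintype.linearCombination R P.gen

/-- `Q`, the kernel of `F → I`. -/
def relations : Submodule R (ι → R) :=
  LinearMap.ker P.toIdeal

/-- `Kos ⊆ Q`, the submodule generated by the Koszul relations `p(a) b - p(b) a`, where `p` is the
surjection `F → I` and `a, b ∈ F`. -/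
def koszul : Submodule R P.relations :=
  Submodule.span R
    {q | ∃ a b : ι → R,
      (q : ι → R) = P.toIdeal a • b - P.toIdeal b • a}

/-- `L₀ = (R / I) ⊗ Ω_{R / A}`. -/
abbrev L0 (_P : HomogeneousGenerators 𝓡 I ι) : Type _ :=
  (R ⧸ I) ⊗[R] (Ω[R⁄A])

/-- `L₁ = (R / I) ⊗ F`. -/
abbrev L1 (_P : HomogeneousGenerators 𝓡 I ι) : Type _ :=
  (R ⧸ I) ⊗[R] (ι → R)

/-- `L₂ = Q / Kos`. -/
abbrev L2 : Type _ := P.relations ⧸ P.koszul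

/-- `d₁ : L₁ → L₀`, `b ⊗ e i ↦ b ⊗ d (gen i)`. -/
def d1 : P.L1 →ₗ[R] P.L0 :=
  LinearMap.lTensor (R ⧸ I)
    (Fintype.linearCombination R
      (fun i => KaehlerDifferential.D A R (P.gen i)))

theorem toIdeal_mem (a : ι → R) : P.toIdeal a ∈ I := by
  rw [toIdeal, Fintype.linearCombination_apply]
  refine Ideal.sum_mem _ fun i _ => ?_
  rw [smul_eq_mul]
  refine I.mul_mem_left _ ?_
  have h : P.gen i ∈ Ideal.span (Set.range P.gen) := Ideal.subset_span ⟨i, rfl⟩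
  rwa [P.span_range_gen] at h

theorem one_tmul_smul_eq_zero {N : Type*} [AddCommGroup N] [Module R N]
    {r : R} (hr : r ∈ I) (n : N) :
    (1 : R ⧸ I) ⊗ₜ[R] (r • n) = 0 := by
  rw [← TensorProduct.smul_tmul, Algebra.smul_def, mul_one, Ideal.Quotient.algebraMap_eq,
    Ideal.Quotient.eq_zero_iff_mem.mpr hr, TensorProduct.zero_tmul]

theorem koszul_le_ker :
    P.koszul ≤ LinearMap.ker
      ((TensorProduct.mk R (R ⧸ I)
        (ι → R) 1).comp P.relations.subtype) := by
  refine Submodule.span_le.mpr ?_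
  rintro q ⟨a, b, hq⟩
  simp only [SetLike.mem_coe, LinearMap.mem_ker, LinearMap.comp_apply, Submodule.subtype_apply,
    TensorProduct.mk_apply, hq, TensorProduct.tmul_sub]
  rw [one_tmul_smul_eq_zero (P.toIdeal_mem a), one_tmul_smul_eq_zero (P.toIdeal_mem b), sub_zero]

/-- `d₂ : L₂ → L₁`, induced by the inclusion `Q ⊆ F`. -/
def d2 : P.L2 →ₗ[R] P.L1 :=
  P.koszul.liftQ
    ((TensorProduct.mk R (R ⧸ I)
      (ι → R) 1).comp P.relations.subtype) P.koszul_le_ker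

/-- The map `Hom(L₀, R / I) → Hom(L₁, R / I)` given by `d₁`. Here and below `Hom` is over `R`,
which for modules over `R / I` is the same as `Hom` over `R / I`. -/
def dual1 : (P.L0 →ₗ[R] (R ⧸ I)) →ₗ[R]
    (P.L1 →ₗ[R] (R ⧸ I)) :=
  LinearMap.lcomp R (R ⧸ I) P.d1

/-- The map `Hom(L₁, R / I) → Hom(L₂, R / I)` given by `d₂`. -/
def dual2 : (P.L1 →ₗ[R] (R ⧸ I)) →ₗ[R]
    (P.L2 →ₗ[R] (R ⧸ I)) :=
  LinearMap.lcomp R (R ⧸ I) P.d2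

/-- `T¹(B/A, B)` for `B = R / I`: the first cohomology of `Hom(L, B)`. -/
abbrev T1 : Type _ :=
  Cohomology P.dual1 P.dual2

/-- `T²(B/A, B)` for `B = R / I`: the second cohomology of `Hom(L, B)`. -/
abbrev T2 : Type _ :=
  (P.L2 →ₗ[R] (R ⧸ I)) ⧸ LinearMap.range P.dual2

/-- The degree `m` part of the graded free module `F`. -/
def freePiece (m : ℤ) : Submodule A (ι → R) where
  carrier := {v | ∀ i, v i ∈ 𝓡 (m - P.deg i)}
  add_mem' hu hv i := Submodule.add_mem _ (hu i) (hv i)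
  zero_mem' _ := Submodule.zero_mem _
  smul_mem' c _ hv i := Submodule.smul_mem _ c (hv i)

/-- The degree `m` part of `L₁ = (R / I) ⊗ F = F / I F`: the image of the degree `m` part
of `F`. -/
def L1Piece (m : ℤ) : Submodule A P.L1 :=
  (P.freePiece m).map
    ((TensorProduct.mk R (R ⧸ I)
      (ι → R) 1).restrictScalars A)

/-- The degree `m` part of `L₂ = Q / Kos`: the image of the degree `m` part of `Q ⊆ F`. -/
def L2Piece (m : ℤ) : Submodule A P.L2 :=
  ((P.freePiece m).comap (P.relations.subtype.restrictScalars A)).map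
    (P.koszul.mkQ.restrictScalars A)

/-- The degree `j` part of `T¹(B/A, B)`: the classes of the cocycles that are homogeneous of
degree `j`. -/
def T1Piece (j : ℤ) : Submodule A P.T1 :=
  cohomologyClasses P.dual1 P.dual2 (homPiece P.L1Piece (quotientPiece 𝓡 I) j)

/-- The degree `j` part of `T²(B/A, B)`: the classes of the maps that are homogeneous of
degree `j`. -/
def T2Piece (j : ℤ) : Submodule A P.T2 :=
  (homPiece P.L2Piece (quotientPiece 𝓡 I) j).map
    ((LinearMap.range P.dual2).mkQ.restrictScalars A)

theorem d1_one_tmul (v : ι → R) :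
    P.d1 ((1 : R ⧸ I) ⊗ₜ[R] v) =
      (1 : R ⧸ I) ⊗ₜ[R] (KaehlerDifferential.D A R (P.toIdeal v)) := by
  have hi : ∀ i, P.gen i ∈ I := fun i => by
    have h : P.gen i ∈ Ideal.span (Set.range P.gen) := Ideal.subset_span ⟨i, rfl⟩
    rwa [P.span_range_gen] at h
  simp only [d1, toIdeal, LinearMap.lTensor_tmul, Fintype.linearCombination_apply, smul_eq_mul,
    map_sum, Derivation.leibniz, TensorProduct.tmul_add, TensorProduct.tmul_sum]
  refine Finset.sum_congr rfl fun i _ => ?_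
  rw [one_tmul_smul_eq_zero (hi i), add_zero]

/-- The maps `d₁`, `d₂` form a complex. -/
theorem d1_comp_d2 : P.d1.comp P.d2 = 0 := by
  refine Submodule.linearMap_qext _ (LinearMap.ext fun q => ?_)
  have hq : P.toIdeal (q : ι → R) = 0 := q.2
  have h := P.d1_one_tmul (q : ι → R)
  rw [hq, map_zero, TensorProduct.tmul_zero] at h
  simpa [d2] using h

end HomogeneousGenerators

/-- The socle of a local ring: the elements killed by the maximal ideal. -/
def socle (B : Type*) [CommRing B] [IsLocalRing B] : Ideal B :=
  (IsLocalRing.maximalIdeal B).annihilator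

section Example

open MvPolynomial

/-- `⟨x,y⟩³ + ⟨z,w⟩³ + ⟨xz - yw⟩` in `k[x,y,z,w]`. -/
def idealI (k : Type*) [Field k] : Ideal (MvPolynomial (Fin 4) k) :=
  Ideal.span {X 0, X 1} ^ 3 + Ideal.span {X 2, X 3} ^ 3 + Ideal.span {X 0 * X 2 - X 1 * X 3}

/-- `⟨x,y⟩³ + ⟨z,w⟩³ + ⟨xz - yw, x²z², x²w², y²z²⟩` in `k[x,y,z,w]`. -/
def idealI3 (k : Type*) [Field k] : Ideal (MvPolynomial (Fin 4) k) :=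
  Ideal.span {X 0, X 1} ^ 3 + Ideal.span {X 2, X 3} ^ 3 +
    Ideal.span {X 0 * X 2 - X 1 * X 3,
      X 0 ^ 2 * X 2 ^ 2, X 0 ^ 2 * X 3 ^ 2, X 1 ^ 2 * X 2 ^ 2}

/-- The degree `m` part of `k[x,y,z,w]` in the standard grading, in which all four variables have
degree `1`; it is zero for `m < 0`. -/
def stdGrading (k : Type*) [Field k] (m : ℤ) : Submodule k (MvPolynomial (Fin 4) k) :=
  weightedHomogeneousSubmodule k (fun _ => (1 : ℤ)) m

end Example

end SmallElementary

end

/-!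
# Socles, tangents and obstructions of a small elementary algebra

Write `S = k[x,y,z,w]`, `I = idealI k`, `J = idealI3 k`.

**Toric coordinates.** The substitution `x = a s`, `y = a`, `z = b`, `w = b s` parametrizes the
quadric `xz = yw`, and turns `I` and `J` into monomial conditions. With `toricCoeff k p q i f` the
coefficient of `aᵖ b^q sⁱ` in the image of `f`, the polynomial `f` lies in `I` if and only if
these coefficients vanish for `p, q < 3` (`mem_idealI_iff`); for `J` the three positions
`p = q = 2`, `i ∈ {0, 2, 4}` are left out as well (`mem_idealI3_iff`). So `S / I` and `S / J` have
the monomials `aᵖ b^q sⁱ`, `i ≤ p + q`, at these positions as bases, and multiplication by a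
variable is a shift of coefficients. An element killed by all four variables can only have
coefficients with `p = q = 2`, which gives the socles (`socle_eq_and_finrank`).

**Change of generators.** Two families of homogeneous generators are related by homogeneous maps in
both directions, so the vanishing of `T¹` and `T²` in a given degree can be checked on the twelve
generators of `J` in `standardGenerators`: for `T¹` one has to see that a homomorphism `J → S / J`
is the restriction of a derivation (`T1Piece_eq_bot`), for `T²` that a homomorphism from the module
of relations to `S / J` extends to the free module (`T2Piece_eq_bot`).

**Negative tangents.** Let `h : J → S / J` have negative degree. Subtracting a derivation with
constant coefficients, the linear part of `h (xz - yw)` becomes zero, and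
`x² h (xz - yw) = z h (x³) - w h (x²y)` kills its constant part. Then `h (x³), h (x²y), h (xy²),
h (y³)` form a geometric progression of length four with ratio `y / x = z / w = 1 / s`, and have
degree at most two; the first would be divisible by `s³`, so all vanish
(`mem_idealI3_of_progression`). The same holds for the cubics in `z, w`. The images of the three
quartics are then killed by all variables and have degree at most three, so they lie in a part of
`S / J` where the socle is zero (`mem_idealI3_of_relations`).

**Obstructions.** Let `φ` be a homomorphism of nonnegative degree from the relations to `S / J`.
As `S / J` vanishes in degrees at least five, `φ` is determined by its values on relations of degree
at most four, and these are spanned by twelve syzygies (`mem_span_syzygy`), whose images lie in the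
socle. Every socle element of degree four can be written as `y U`, with `U` a cubic such that
`x U = z U = w U = 0`, and similarly with `z`, `x` and `w` in place of `y` (`exists_top_xy`,
`exists_top_zw`). This is enough freedom to choose the images of the generators so that the twelve
values of `φ` are attained.
-/

noncomputable section

namespace SmallElementary

/-! ### Change of generators -/

namespace HomogeneousGenerators

variable {A R ι ι₀ : Type*} [CommRing A] [CommRing R] [Algebra A R] [Fintype ι] [Fintype ι₀]
  {𝓡 : ℤ → Submodule A R} {I : Ideal R}

theorem toIdeal_apply (P : HomogeneousGenerators 𝓡 I ι) (v : ι → R) :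
    P.toIdeal v = ∑ i, v i * P.gen i := by
  simp [toIdeal, Fintype.linearCombination_apply]

theorem range_toIdeal (P : HomogeneousGenerators 𝓡 I ι) : LinearMap.range P.toIdeal = I := by
  rw [toIdeal, Fintype.range_linearCombination]
  exact P.span_range_gen

theorem exists_toIdeal_eq (P : HomogeneousGenerators 𝓡 I ι) {f : R} (hf : f ∈ I) :
    ∃ v, P.toIdeal v = f := by
  rwa [← P.range_toIdeal] at hf

omit [Fintype ι] in
theorem gen_mem_ideal (P : HomogeneousGenerators 𝓡 I ι) (i : ι) : P.gen i ∈ I := by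
  have h : P.gen i ∈ Ideal.span (Set.range P.gen) := Ideal.subset_span ⟨i, rfl⟩
  rwa [P.span_range_gen] at h

section Graded

variable [GradedAlgebra 𝓡]

/-- The component of degree `m` of an element of the graded free module `F`. -/
def component (P : HomogeneousGenerators 𝓡 I ι) (m : ℤ) (v : ι → R) : ι → R :=
  fun i => DirectSum.decompose 𝓡 (v i) (m - P.deg i)

omit [Fintype ι] in
theorem component_mem (P : HomogeneousGenerators 𝓡 I ι) (m : ℤ) (v : ι → R) :
    P.component m v ∈ P.freePiece m :=
  fun _ => SetLike.coe_mem _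

theorem toIdeal_component (P : HomogeneousGenerators 𝓡 I ι) (m : ℤ) (v : ι → R) :
    P.toIdeal (P.component m v) = DirectSum.decompose 𝓡 (P.toIdeal v) m := by
  rw [toIdeal_apply, toIdeal_apply, DirectSum.decompose_sum, DFinsupp.finsetSum_apply,
    AddSubmonoidClass.coe_finsetSum]
  refine Finset.sum_congr rfl fun i _ => ?_
  have h := DirectSum.coe_decompose_mul_add_of_right_mem 𝓡 (a := v i) (i := m - P.deg i)
    (P.gen_mem i)
  rw [sub_add_cancel] at h
  rw [h, component]

theorem exists_eq_sum_component (P : HomogeneousGenerators 𝓡 I ι) (v : ι → R) :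
    ∃ s : Finset ℤ, v = ∑ m ∈ s, P.component m v := by
  classical
  refine ⟨Finset.univ.biUnion fun i =>
    (DirectSum.decompose 𝓡 (v i)).support.image (· + P.deg i), funext fun i => ?_⟩
  rw [Finset.sum_apply]
  have h1 := DirectSum.sum_support_decompose 𝓡 (v i)
  have h2 : ∑ m ∈ (DirectSum.decompose 𝓡 (v i)).support.image (· + P.deg i),
      P.component m v i = v i := by
    rw [Finset.sum_image fun a _ b _ h => add_right_cancel h]
    refine Eq.trans (Finset.sum_congr rfl fun n _ => ?_) h1
    rw [component, add_sub_cancel_right]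
  conv_lhs => rw [← h2]
  refine Finset.sum_subset (fun m hm => Finset.mem_biUnion.mpr ⟨i, Finset.mem_univ i, hm⟩) ?_
  intro m _ hm
  by_contra hne
  refine hm (Finset.mem_image.mpr ⟨m - P.deg i, ?_, sub_add_cancel _ _⟩)
  rw [DFinsupp.mem_support_iff]
  exact fun h0 => hne (by simp [component, h0])

theorem exists_mem_freePiece_toIdeal_eq (P : HomogeneousGenerators 𝓡 I ι) {f : R} (hf : f ∈ I)
    {m : ℤ} (hm : f ∈ 𝓡 m) : ∃ v ∈ P.freePiece m, P.toIdeal v = f := by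
  obtain ⟨v, rfl⟩ := P.exists_toIdeal_eq hf
  exact ⟨P.component m v, P.component_mem m v, by
    rw [toIdeal_component, DirectSum.decompose_of_mem_same 𝓡 hm]⟩

/-- Two families of homogeneous generators of the same ideal are related by a map of degree zero
between the free modules, compatible with the surjections to the ideal. -/
theorem exists_comparison (P₀ : HomogeneousGenerators 𝓡 I ι₀) (P : HomogeneousGenerators 𝓡 I ι) :
    ∃ α : (ι₀ → R) →ₗ[R] (ι → R), (∀ v, P.toIdeal (α v) = P₀.toIdeal v) ∧
      ∀ m, ∀ v ∈ P₀.freePiece m, α v ∈ P.freePiece m := by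
  choose u hu hu' using fun i =>
    P.exists_mem_freePiece_toIdeal_eq (P₀.gen_mem_ideal i) (P₀.gen_mem i)
  refine ⟨Fintype.linearCombination R u, fun v => ?_, fun m v hv i => ?_⟩
  · simp [Fintype.linearCombination_apply, hu', toIdeal_apply P₀]
  · rw [Fintype.linearCombination_apply, Finset.sum_apply]
    refine Submodule.sum_mem _ fun l _ => ?_
    have h := SetLike.mul_mem_graded (hv l) (hu l i)
    rwa [sub_add_sub_cancel] at h

/-- A linear map on `F = ι → R` in terms of the images of the basis vectors. -/
theorem _root_.LinearMap.apply_eq_sum_single {R ι N : Type*} [CommRing R] [Fintype ι]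
    [DecidableEq ι] [AddCommGroup N] [Module R N] (Φ : (ι → R) →ₗ[R] N) (r : ι → R) :
    Φ r = ∑ i, r i • Φ (Pi.single i 1) := by
  rw [LinearMap.pi_apply_eq_sum_univ]
  refine Finset.sum_congr rfl fun i _ => ?_
  congr 2
  ext l
  simp [Pi.single_apply, eq_comm]

omit [Fintype ι] in
theorem single_mem_freePiece [DecidableEq ι] (P : HomogeneousGenerators 𝓡 I ι) (i : ι) :
    Pi.single i 1 ∈ P.freePiece (P.deg i) := by
  intro l
  rcases eq_or_ne l i with rfl | hl
  · simpa using SetLike.one_mem_graded 𝓡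
  · simp [hl]

omit [GradedAlgebra 𝓡] in
/-- A homomorphism `I → R / I` that is the restriction of a derivation comes from `L₀`. -/
theorem mem_range_dual1 (P : HomogeneousGenerators 𝓡 I ι) {φ : P.L1 →ₗ[R] R ⧸ I}
    (D : Derivation A R (R ⧸ I)) (h : ∀ v : ι → R, φ (1 ⊗ₜ v) = D (P.toIdeal v)) :
    φ ∈ LinearMap.range P.dual1 := by
  refine ⟨(LinearMap.mul' R (R ⧸ I)).comp
    (LinearMap.lTensor (R ⧸ I) D.liftKaehlerDifferential), TensorProduct.ext' fun b v => ?_⟩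
  obtain ⟨r, rfl⟩ := Ideal.Quotient.mk_surjective b
  have hb : (Ideal.Quotient.mk I r) ⊗ₜ[R] v = r • ((1 : R ⧸ I) ⊗ₜ[R] v) := by
    rw [TensorProduct.smul_tmul', Algebra.smul_def, mul_one, Ideal.Quotient.algebraMap_eq]
  rw [hb, map_smul, map_smul, h, dual1, LinearMap.lcomp_apply, d1_one_tmul]
  simp

omit [GradedAlgebra 𝓡] in
/-- The degree `j` part of `T¹` vanishes if all cocycles of degree `j` are coboundaries. -/
theorem T1Piece_eq_bot_of_forall (P : HomogeneousGenerators 𝓡 I ι) (j : ℤ)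
    (H : ∀ φ ∈ homPiece P.L1Piece (quotientPiece 𝓡 I) j, φ ∈ LinearMap.ker P.dual2 →
      φ ∈ LinearMap.range P.dual1) : P.T1Piece j = ⊥ := by
  rw [eq_bot_iff]
  rintro _ ⟨φ, hφj, rfl⟩
  exact (Submodule.Quotient.mk_eq_zero _).mpr (H φ.1 hφj φ.2)

/-- `T¹` in degree `j` vanishes as soon as, for one family of generators `f i` of `I`, every
homomorphism `I → R / I` of degree `j` (given by the images `h i` of the `f i`) is the restriction
of a derivation. -/
theorem T1Piece_eq_bot (P₀ : HomogeneousGenerators 𝓡 I ι₀) (P : HomogeneousGenerators 𝓡 I ι)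
    (j : ℤ)
    (H : ∀ h : ι₀ → R ⧸ I, (∀ i, h i ∈ quotientPiece 𝓡 I (P₀.deg i + j)) →
      (∀ r ∈ P₀.relations, ∑ i, r i • h i = 0) →
      ∃ D : Derivation A R (R ⧸ I), ∀ i, h i = D (P₀.gen i)) :
    P.T1Piece j = ⊥ := by
  classical
  refine P.T1Piece_eq_bot_of_forall j fun φ hφj' hφ => ?_
  have hrel : ∀ v ∈ P.relations, φ (1 ⊗ₜ v) = 0 := fun v hv => by
    have h := LinearMap.congr_fun (LinearMap.mem_ker.mp hφ) (P.koszul.mkQ ⟨v, hv⟩)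
    simpa [dual2, d2] using h
  obtain ⟨α, hα, hα'⟩ := exists_comparison P₀ P
  set Φ : (ι → R) →ₗ[R] R ⧸ I := φ.comp (TensorProduct.mk R (R ⧸ I) (ι → R) 1)
  have hΦα : ∀ r : ι₀ → R, Φ (α r) = ∑ i, r i • Φ (α (Pi.single i 1)) := fun r =>
    (Φ.comp α).apply_eq_sum_single r
  obtain ⟨D, hD⟩ := H (fun i => Φ (α (Pi.single i 1)))
    (fun i => hφj' _ _ ⟨α (Pi.single i 1), hα' _ _ (P₀.single_mem_freePiece i), rfl⟩)
    (fun r hr => by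
      rw [← hΦα r]
      exact hrel _ (by rw [relations, LinearMap.mem_ker, hα]; exact hr))
  have hmain : ∀ v, Φ v = D (P.toIdeal v) := by
    intro v
    obtain ⟨w, hw⟩ := P₀.exists_toIdeal_eq (P.toIdeal_mem v)
    have h0 : Φ (v - α w) = 0 :=
      hrel _ (by rw [relations, LinearMap.mem_ker, map_sub, hα, hw, sub_self])
    rw [map_sub, sub_eq_zero] at h0
    rw [h0, hΦα, ← hw, toIdeal_apply, map_sum]
    refine Finset.sum_congr rfl fun i _ => ?_
    have h1 : P₀.gen i • D (w i) = 0 := by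
      rw [Algebra.smul_def, Ideal.Quotient.algebraMap_eq,
        Ideal.Quotient.eq_zero_iff_mem.mpr (P₀.gen_mem_ideal i), zero_mul]
    rw [D.leibniz, h1, add_zero]
    exact congrArg _ (hD i)
  exact P.mem_range_dual1 D hmain

/-- `T²` in degree `j` vanishes as soon as, for one family of generators of `I`, every homomorphism
of degree `j` from its relations to `R / I` extends to the free module. -/
theorem T2Piece_eq_bot (P₀ : HomogeneousGenerators 𝓡 I ι₀) (P : HomogeneousGenerators 𝓡 I ι)
    (j : ℤ)
    (H : ∀ φ : P₀.relations →ₗ[R] R ⧸ I,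
      (∀ m, ∀ v : P₀.relations, (v : ι₀ → R) ∈ P₀.freePiece m →
        φ v ∈ quotientPiece 𝓡 I (m + j)) →
      ∃ ψ : (ι₀ → R) →ₗ[R] R ⧸ I, ∀ v : P₀.relations, φ v = ψ v) :
    P.T2Piece j = ⊥ := by
  classical
  rw [eq_bot_iff]
  rintro _ ⟨φ, hφj, rfl⟩
  change (LinearMap.range P.dual2).mkQ φ = 0
  rw [Submodule.mkQ_apply, Submodule.Quotient.mk_eq_zero]
  have hφj' : ∀ m, ∀ x ∈ P.L2Piece m, φ x ∈ quotientPiece 𝓡 I (m + j) := hφj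
  obtain ⟨α, hα, hα'⟩ := exists_comparison P₀ P
  obtain ⟨β, hβ, -⟩ := exists_comparison P P₀
  set Φ : P.relations →ₗ[R] R ⧸ I := φ.comp P.koszul.mkQ
  have hαrel : ∀ v ∈ P₀.relations, α v ∈ P.relations := fun v hv => by
    rw [relations, LinearMap.mem_ker, hα]; exact hv
  have hβrel : ∀ v ∈ P.relations, β v ∈ P₀.relations := fun v hv => by
    rw [relations, LinearMap.mem_ker, hβ]; exact hv
  obtain ⟨ψ, hψ⟩ := H (Φ.comp (α.restrict hαrel)) fun m v hv =>
    hφj' _ _ ⟨⟨α v, hαrel v v.2⟩, hα' _ _ hv, rfl⟩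
  -- `v - α (β v)` is a relation for every `v`, so that `φ` can be applied to it
  let δ : (ι → R) →ₗ[R] P.relations :=
    (LinearMap.id - α.comp β).codRestrict P.relations fun v => by
      simp [relations, LinearMap.mem_ker, hα, hβ]
  refine ⟨(LinearMap.mul' R (R ⧸ I)).comp
    (LinearMap.lTensor (R ⧸ I) (ψ.comp β + Φ.comp δ)),
    Submodule.linearMap_qext _ (LinearMap.ext fun q => ?_)⟩
  have h1 : Φ ⟨α (β q), hαrel _ (hβrel q q.2)⟩ = ψ (β q) := hψ ⟨β q, hβrel q q.2⟩
  have h2 : q = ⟨α (β q), hαrel _ (hβrel q q.2)⟩ + δ q := by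
    refine Subtype.ext ?_
    change (q : ι → R) = α (β q) + (q - α (β q))
    rw [add_sub_cancel]
  have h3 : Φ q = ψ (β q) + Φ (δ q) := by
    rw [← h1, ← map_add, ← h2]
  change _ = Φ q
  rw [h3]
  simp [dual2, d2]

end Graded
end HomogeneousGenerators

open MvPolynomial

variable {k : Type*} [Field k]

/-! ### The quadric and normal forms -/

/-- The monomial `xᵃ yᵇ zᶜ wᵈ`. -/
def mono (k : Type*) [Field k] (a b c d : ℕ) : MvPolynomial (Fin 4) k :=
  X 0 ^ a * X 1 ^ b * X 2 ^ c * X 3 ^ d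

theorem mono_mul_mono (a b c d a' b' c' d' : ℕ) :
    mono k a b c d * mono k a' b' c' d' = mono k (a + a') (b + b') (c + c') (d + d') := by
  simp only [mono]; ring

/-- Induction over the monomials `r xᵃ yᵇ zᶜ wᵈ`. -/
theorem induction_on_mono {motive : MvPolynomial (Fin 4) k → Prop} (f : MvPolynomial (Fin 4) k)
    (add : ∀ f g, motive f → motive g → motive (f + g))
    (smul_mono : ∀ (r : k) (a b c d : ℕ), motive (r • mono k a b c d)) : motive f := by
  refine f.induction_on' (fun u r => ?_) add
  have h := smul_mono r (u 0) (u 1) (u 2) (u 3)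
  rwa [mono, smul_eq_C_mul, ← Fin.prod_univ_four (fun i => X i ^ u i),
    ← Finsupp.prod_fintype _ _ (by simp), ← monomial_eq] at h

/-- The parametrization `x = a s`, `y = a`, `z = b`, `w = b s` of the quadric `xz = yw`. -/
def toricMap (k : Type*) [Field k] : MvPolynomial (Fin 4) k →ₐ[k] MvPolynomial (Fin 3) k :=
  aeval ![X 0 * X 2, X 0, X 1, X 1 * X 2]

/-- The exponent of `aᵖ b^q sⁱ`. -/
def triple (p q i : ℕ) : Fin 3 →₀ ℕ :=
  Finsupp.single 0 p + Finsupp.single 1 q + Finsupp.single 2 i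

theorem triple_inj {p q i p' q' i' : ℕ} :
    triple p q i = triple p' q' i' ↔ p = p' ∧ q = q' ∧ i = i' := by
  refine ⟨fun h => ⟨?_, ?_, ?_⟩, by rintro ⟨rfl, rfl, rfl⟩; rfl⟩
  · simpa [triple] using DFunLike.congr_fun h 0
  · simpa [triple] using DFunLike.congr_fun h 1
  · simpa [triple] using DFunLike.congr_fun h 2

/-- The coefficient of `aᵖ b^q sⁱ` in the restriction of a polynomial to the quadric `xz = yw`: the
sum of the coefficients of all monomials of degree `p` in `x, y`, degree `q` in `z, w`, and degree
`i` in `x, w`. -/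
def toricCoeff (k : Type*) [Field k] (p q i : ℕ) : MvPolynomial (Fin 4) k →ₗ[k] k :=
  (lcoeff k (triple p q i)).comp (toricMap k).toLinearMap

theorem toricCoeff_apply (p q i : ℕ) (f : MvPolynomial (Fin 4) k) :
    toricCoeff k p q i f = coeff (triple p q i) (toricMap k f) := rfl

theorem toricMap_mono (a b c d : ℕ) :
    toricMap k (mono k a b c d) = monomial (triple (a + b) (c + d) (a + d)) 1 := by
  have h (u : Fin 3) (n : ℕ) : (X u ^ n : MvPolynomial (Fin 3) k)
    = monomial (Finsupp.single u n) 1 := X_pow_eq_monomial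
  simp only [mono, toricMap, map_mul, map_pow, aeval_X, Matrix.cons_val, mul_pow, h,
    monomial_mul, mul_one]
  congr 2
  ext u
  fin_cases u <;> simp [triple]

theorem toricCoeff_mono (p q i a b c d : ℕ) :
    toricCoeff k p q i (mono k a b c d) =
      if a + b = p ∧ c + d = q ∧ a + d = i then 1 else 0 := by
  rw [toricCoeff_apply, toricMap_mono, coeff_monomial]
  simp only [triple_inj]

theorem toricCoeff_mono_mul (p q i a b c d : ℕ) (f : MvPolynomial (Fin 4) k) :
    toricCoeff k p q i (mono k a b c d * f) =
      if a + b ≤ p ∧ c + d ≤ q ∧ a + d ≤ i then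
        toricCoeff k (p - (a + b)) (q - (c + d)) (i - (a + d)) f else 0 := by
  induction f using induction_on_mono with
  | add f g hf hg =>
    rw [mul_add, map_add, hf, hg]
    split_ifs <;> simp
  | smul_mono r a' b' c' d' =>
    rw [mul_smul_comm, map_smul, mono_mul_mono, map_smul, toricCoeff_mono, toricCoeff_mono]
    have : a + a' + (b + b') = p ∧ c + c' + (d + d') = q ∧ a + a' + (d + d') = i ↔
      (a + b ≤ p ∧ c + d ≤ q ∧ a + d ≤ i) ∧
        (a' + b' = p - (a + b) ∧ c' + d' = q - (c + d) ∧ a' + d' = i - (a + d)) := by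
      omega
    simp only [this]
    split_ifs <;> simp_all

theorem toricCoeff_eq_zero_of_lt {p q i : ℕ} (h : p + q < i) (f : MvPolynomial (Fin 4) k) :
    toricCoeff k p q i f = 0 := by
  induction f using induction_on_mono with
  | add f g hf hg => rw [map_add, hf, hg, add_zero]
  | smul_mono r a b c d =>
    rw [map_smul, toricCoeff_mono, if_neg (by omega), smul_zero]

theorem mono_mem_stdGrading (a b c d : ℕ) :
    mono k a b c d ∈ stdGrading k (a + b + c + d : ℕ) := by
  have h (i : Fin 4) (n : ℕ) : (X i ^ n : MvPolynomial (Fin 4) k).IsWeightedHomogeneous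
      (fun _ => (1 : ℤ)) n := by
    simpa using (isWeightedHomogeneous_X k (fun _ => (1 : ℤ)) i).pow n
  have := (((h 0 a).mul (h 1 b)).mul (h 2 c)).mul (h 3 d)
  exact_mod_cast this

theorem toricCoeff_eq_zero_of_mem_stdGrading {p q i : ℕ} {m : ℤ} {f : MvPolynomial (Fin 4) k}
    (hf : f ∈ stdGrading k m) (h : (p + q : ℤ) ≠ m) : toricCoeff k p q i f = 0 := by
  rw [← hf.weightedHomogeneousComponent_same]
  clear hf
  induction f using induction_on_mono with
  | add f g hf hg => rw [map_add, map_add, hf, hg, add_zero]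
  | smul_mono r a b c d =>
    rw [map_smul, map_smul, weightedHomogeneousComponent_of_mem (mono_mem_stdGrading a b c d)]
    split_ifs with hm
    · rw [toricCoeff_mono, if_neg (by omega), smul_zero]
    · rw [map_zero, smul_zero]

/-- `aᵖ b^q sⁱ` for `i ≤ p + q` as a monomial in `x, y, z, w`, with the largest possible power
of `x`. -/
def normalMono (k : Type*) [Field k] (p q i : ℕ) : MvPolynomial (Fin 4) k :=
  mono k (min i p) (p - min i p) (q - (i - min i p)) (i - min i p)

theorem span_pair_pow_three {R : Type*} [CommRing R] (x y : R) :
    Ideal.span {x, y} ^ 3 = Ideal.span {x ^ 3, x ^ 2 * y, x * y ^ 2, y ^ 3} := by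
  apply le_antisymm
  · rw [pow_succ, pow_two, Ideal.span_mul_span', Ideal.span_mul_span', Ideal.span_le]
    rintro _ ⟨_, ⟨a, ha, b, hb, rfl⟩, c, hc, rfl⟩
    have h : ∀ u ∈ ({x ^ 3, x ^ 2 * y, x * y ^ 2, y ^ 3} : Set R),
        u ∈ Ideal.span {x ^ 3, x ^ 2 * y, x * y ^ 2, y ^ 3} := fun u hu => Ideal.subset_span hu
    simp only [Set.mem_insert_iff, Set.mem_singleton_iff, forall_eq_or_imp, forall_eq] at h
    obtain ⟨h1, h2, h3, h4⟩ := h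
    change a * b * c ∈ Ideal.span _
    rcases ha with rfl | rfl <;> rcases hb with rfl | rfl <;> rcases hc with rfl | rfl
    · convert h1 using 1; ring
    · convert h2 using 1; ring
    · convert h2 using 1; ring
    · convert h3 using 1; ring
    · convert h2 using 1; ring
    · convert h3 using 1; ring
    · convert h3 using 1; ring
    · convert h4 using 1; ring
  · have hx : x ∈ Ideal.span {x, y} := Ideal.subset_span (by simp)
    have hy : y ∈ Ideal.span {x, y} := Ideal.subset_span (by simp)
    have hm {a b c : R} (ha : a ∈ Ideal.span {x, y}) (hb : b ∈ Ideal.span {x, y})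
        (hc : c ∈ Ideal.span {x, y}) : a * b * c ∈ Ideal.span {x, y} ^ 3 := by
      rw [pow_succ, pow_two]
      exact Ideal.mul_mem_mul (Ideal.mul_mem_mul ha hb) hc
    rw [Ideal.span_le]
    rintro _ (rfl | rfl | rfl | rfl) <;> rw [SetLike.mem_coe]
    · convert hm hx hx hx using 1; ring
    · convert hm hx hx hy using 1; ring
    · convert hm hx hy hy using 1; ring
    · convert hm hy hy hy using 1; ring

/-- The cubics and the quadric generating `idealI`. -/
def cubicsAndQuadric (k : Type*) [Field k] : Set (MvPolynomial (Fin 4) k) :=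
  {mono k 3 0 0 0, mono k 2 1 0 0, mono k 1 2 0 0, mono k 0 3 0 0,
    mono k 0 0 3 0, mono k 0 0 2 1, mono k 0 0 1 2, mono k 0 0 0 3, 
    mono k 1 0 1 0 - mono k 0 1 0 1}

/-- The three quartics that generate `idealI3` over `idealI`. -/
def quartics (k : Type*) [Field k] : Set (MvPolynomial (Fin 4) k) :=
  {mono k 2 0 2 0, mono k 2 0 0 2, mono k 0 2 2 0}

theorem idealI_eq_span : idealI k = Ideal.span (cubicsAndQuadric k) := by
  rw [idealI, span_pair_pow_three, span_pair_pow_three, Ideal.add_eq_sup,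
    Ideal.add_eq_sup, ← Ideal.span_union, ← Ideal.span_union]
  congr 1
  ext f
  simp only [cubicsAndQuadric, mono, pow_zero, pow_one, mul_one, one_mul, Set.mem_insert_iff,
    Set.mem_singleton_iff, Set.mem_union, or_assoc]

theorem idealI3_eq_sup : idealI3 k = idealI k ⊔ Ideal.span (quartics k) := by
  rw [idealI, idealI3]
  simp only [Ideal.add_eq_sup, sup_assoc]
  congr 2
  rw [← Ideal.span_union]
  congr 1
  ext f
  simp only [quartics, mono, pow_zero, mul_one, one_mul, Set.mem_insert_iff,
    Set.mem_singleton_iff, Set.mem_union]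

theorem idealI3_eq_span : idealI3 k = Ideal.span (cubicsAndQuadric k ∪ quartics k) := by
  rw [idealI3_eq_sup, idealI_eq_span, Ideal.span_union]

/-- A set `K` of monomials `aᵖ b^q sⁱ` that is closed under division by the images
`a^(a' + b') b^(c' + d') s^(a' + d')` of the monomials in `x, y, z, w`. -/
def IsLowerFamily (K : ℕ → ℕ → ℕ → Prop) : Prop :=
  ∀ p q i a b c d, K (p + (a + b)) (q + (c + d)) (i + (a + d)) → K p q i

/-- The polynomials without coefficients in `K` form an ideal, so it suffices to check
generators. -/
theorem IsLowerFamily.toricCoeff_eq_zero {K : ℕ → ℕ → ℕ → Prop} (hK : IsLowerFamily K)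
    {s : Set (MvPolynomial (Fin 4) k)}
    (hs : ∀ g ∈ s, ∀ p q i, K p q i → toricCoeff k p q i g = 0)
    {f : MvPolynomial (Fin 4) k} (hf : f ∈ Ideal.span s) {p q i : ℕ} (h : K p q i) :
    toricCoeff k p q i f = 0 := by
  revert p q i
  induction hf using Submodule.span_induction with
  | mem g hg => exact fun h => hs g hg _ _ _ h
  | zero => exact fun _ => map_zero _
  | add f g _ _ hf hg => intro p q i h; rw [map_add, hf h, hg h, add_zero]
  | smul r f _ hf =>
    intro p q i h
    rw [smul_eq_mul]
    induction r using induction_on_mono with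
    | add r r' hr hr' => rw [add_mul, map_add, hr, hr', add_zero]
    | smul_mono c a' b' c' d' =>
      rw [smul_mul_assoc, map_smul, toricCoeff_mono_mul]
      split_ifs with hle
      · obtain ⟨h1, h2, h3⟩ := hle
        rw [hf (hK _ _ _ a' b' c' d' (by rwa [Nat.sub_add_cancel h1, Nat.sub_add_cancel h2,
          Nat.sub_add_cancel h3])), smul_zero]
      · rw [smul_zero]

/-- The exponents of the monomials `aᵖ b^q sⁱ` whose coefficients vanish on `idealI`. Those with
`i ≤ p + q` give a basis of `k[x,y,z,w] / idealI`. -/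
def supportI (p q _i : ℕ) : Prop := p < 3 ∧ q < 3

/-- The exponents of the monomials `aᵖ b^q sⁱ` whose coefficients vanish on `idealI3`. Those with
`i ≤ p + q` give a basis of `k[x,y,z,w] / idealI3`. -/
def supportI3 (p q i : ℕ) : Prop :=
  p < 3 ∧ q < 3 ∧ ¬ (p = 2 ∧ q = 2 ∧ (i = 0 ∨ i = 2 ∨ i = 4))

theorem isLowerFamily_supportI : IsLowerFamily supportI := by
  intro p q i a b c d h
  unfold supportI at *
  omega

theorem isLowerFamily_supportI3 : IsLowerFamily supportI3 := by
  intro p q i a b c d h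
  unfold supportI3 at *
  omega

theorem toricCoeff_cubicsAndQuadric {g : MvPolynomial (Fin 4) k} (hg : g ∈ cubicsAndQuadric k)
    {p q i : ℕ} (hp : p < 3) (hq : q < 3) : toricCoeff k p q i g = 0 := by
  rcases hg with rfl | rfl | rfl | rfl | rfl | rfl | rfl | rfl | rfl
  on_goal 9 => rw [map_sub, toricCoeff_mono, toricCoeff_mono, sub_self]
  all_goals rw [toricCoeff_mono, if_neg (by omega)]

theorem toricCoeff_quartics {g : MvPolynomial (Fin 4) k} (hg : g ∈ quartics k)
    {p q i : ℕ} (h : supportI3 p q i) : toricCoeff k p q i g = 0 := by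
  unfold supportI3 at h
  rcases hg with rfl | rfl | rfl <;> rw [toricCoeff_mono, if_neg (by omega)]

theorem mono_mem_idealI {a b c d : ℕ} (h : 3 ≤ a + b ∨ 3 ≤ c + d) : mono k a b c d ∈ idealI k := by
  rw [idealI, mono, Ideal.add_eq_sup, Ideal.add_eq_sup]
  have hpow (u v : Fin 4) (m n : ℕ) (hmn : 3 ≤ m + n) :
      (X u ^ m * X v ^ n : MvPolynomial (Fin 4) k) ∈ Ideal.span {X u, X v} ^ 3 := by
    refine Ideal.pow_le_pow_right hmn ?_
    rw [pow_add]
    exact Ideal.mul_mem_mul (Ideal.pow_mem_pow (Ideal.subset_span (by simp)) _)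
      (Ideal.pow_mem_pow (Ideal.subset_span (by simp)) _)
  rcases h with h | h
  · rw [mul_assoc]
    exact Ideal.mem_sup_left (Ideal.mem_sup_left (Ideal.mul_mem_right _ _ (hpow 0 1 a b h)))
  · rw [mul_assoc]
    exact Ideal.mem_sup_left (Ideal.mem_sup_right (Ideal.mul_mem_left _ _ (hpow 2 3 c d h)))

theorem quadric_mem_idealI : mono k 1 0 1 0 - mono k 0 1 0 1 ∈ idealI k := by
  rw [idealI_eq_span]
  exact Ideal.subset_span (by simp [cubicsAndQuadric])

/-- Modulo the quadric, monomials with the same image under `toricMap` agree. -/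
theorem mk_mono_add (a b c d n : ℕ) :
    Ideal.Quotient.mk (idealI k) (mono k a (b + n) c (d + n)) =
      Ideal.Quotient.mk (idealI k) (mono k (a + n) b (c + n) d) := by
  have h : Ideal.Quotient.mk (idealI k) (mono k 0 1 0 1) =
      Ideal.Quotient.mk (idealI k) (mono k 1 0 1 0) :=
    ((Ideal.Quotient.mk_eq_mk_iff_sub_mem _ _).mpr quadric_mem_idealI).symm
  have h1 : mono k a (b + n) c (d + n) = mono k a b c d * mono k 0 1 0 1 ^ n := by
    simp only [mono]; ring
  have h2 : mono k (a + n) b (c + n) d = mono k a b c d * mono k 1 0 1 0 ^ n := by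
    simp only [mono]; ring
  rw [h1, h2, map_mul, map_mul, map_pow, map_pow, h]

theorem mk_mono_eq_normalMono (a b c d : ℕ) :
    Ideal.Quotient.mk (idealI k) (mono k a b c d) =
      Ideal.Quotient.mk (idealI k) (normalMono k (a + b) (c + d) (a + d)) := by
  rcases le_total b d with h | h
  · obtain ⟨e, rfl⟩ := Nat.exists_eq_add_of_le h
    have := mk_mono_add (k := k) a 0 c e b
    rw [Nat.zero_add, Nat.add_comm e b] at this
    rw [this, normalMono]
    congr 2 <;> omega
  · obtain ⟨e, rfl⟩ := Nat.exists_eq_add_of_le h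
    have := mk_mono_add (k := k) a e c 0 d
    rw [Nat.zero_add, Nat.add_comm e d] at this
    rw [this, normalMono]
    congr 2 <;> omega

/-- The normal form of a polynomial modulo `idealI`. -/
theorem mk_eq_sum_normalMono (f : MvPolynomial (Fin 4) k) :
    Ideal.Quotient.mk (idealI k) f =
      ∑ p ∈ Finset.range 3, ∑ q ∈ Finset.range 3, ∑ i ∈ Finset.range 5,
        toricCoeff k p q i f • Ideal.Quotient.mk (idealI k) (normalMono k p q i) := by
  induction f using induction_on_mono with
  | add f g hf hg => simp only [map_add, add_smul, Finset.sum_add_distrib, ← hf, ← hg]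
  | smul_mono r a b c d =>
    have h0 : Ideal.Quotient.mk (idealI k) (r • mono k a b c d) =
      r • Ideal.Quotient.mk (idealI k) (mono k a b c d) := rfl
    rw [h0]
    simp only [map_smul, smul_assoc, ← Finset.smul_sum]
    congr 1
    by_cases h : 3 ≤ a + b ∨ 3 ≤ c + d
    · rw [Ideal.Quotient.eq_zero_iff_mem.mpr (mono_mem_idealI h)]
      symm
      refine Finset.sum_eq_zero fun p hp => Finset.sum_eq_zero fun q hq =>
        Finset.sum_eq_zero fun i _ => ?_
      rw [Finset.mem_range] at hp hq
      rw [toricCoeff_mono, if_neg (by omega), zero_smul]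
    · push Not at h
      rw [Finset.sum_eq_single_of_mem (a + b) (Finset.mem_range.mpr h.1),
        Finset.sum_eq_single_of_mem (c + d) (Finset.mem_range.mpr h.2),
        Finset.sum_eq_single_of_mem (a + d) (Finset.mem_range.mpr (by omega)),
        toricCoeff_mono, if_pos ⟨rfl, rfl, rfl⟩, one_smul, mk_mono_eq_normalMono]
      · intro i _ hi
        rw [toricCoeff_mono, if_neg (by omega), zero_smul]
      · intro q _ hq
        exact Finset.sum_eq_zero fun i _ => by
          rw [toricCoeff_mono, if_neg (by omega), zero_smul]
      · intro p _ hp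
        exact Finset.sum_eq_zero fun q _ => Finset.sum_eq_zero fun i _ => by
          rw [toricCoeff_mono, if_neg (by omega), zero_smul]

theorem mem_idealI_iff {f : MvPolynomial (Fin 4) k} :
    f ∈ idealI k ↔ ∀ p q i, supportI p q i → toricCoeff k p q i f = 0 := by
  constructor
  · intro hf p q i h
    rw [idealI_eq_span] at hf
    exact isLowerFamily_supportI.toricCoeff_eq_zero
      (fun g hg p q i h => toricCoeff_cubicsAndQuadric hg h.1 h.2) hf h
  · intro h
    rw [← Ideal.Quotient.eq_zero_iff_mem, mk_eq_sum_normalMono]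
    refine Finset.sum_eq_zero fun p hp => Finset.sum_eq_zero fun q hq =>
        Finset.sum_eq_zero fun i _ => ?_
    rw [h p q i ⟨Finset.mem_range.mp hp, Finset.mem_range.mp hq⟩, zero_smul]

theorem idealI_le_idealI3 : idealI k ≤ idealI3 k := by
  rw [idealI3_eq_sup]
  exact le_sup_left

theorem mem_idealI3_iff {f : MvPolynomial (Fin 4) k} :
    f ∈ idealI3 k ↔ ∀ p q i, supportI3 p q i → toricCoeff k p q i f = 0 := by
  constructor
  · intro hf p q i h
    rw [idealI3_eq_span] at hf
    refine isLowerFamily_supportI3.toricCoeff_eq_zero ?_ hf h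
    rintro g (hg | hg) p q i h
    · exact toricCoeff_cubicsAndQuadric hg h.1 h.2.1
    · exact toricCoeff_quartics hg h
  · intro h
    have hmem : ∀ g ∈ quartics k, g ∈ idealI3 k := fun g hg => by
      rw [idealI3_eq_span]
      exact Ideal.subset_span (Or.inr hg)
    -- the part of `f` at the three positions that `idealI` does not control
    set g := toricCoeff k 2 2 2 f • mono k 2 0 2 0 + toricCoeff k 2 2 4 f • mono k 2 0 0 2 +
      toricCoeff k 2 2 0 f • mono k 0 2 2 0 with hg
    have hgmem : g ∈ idealI3 k :=
      add_mem (add_mem (Submodule.smul_of_tower_mem _ _ (hmem _ (by simp [quartics])))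
        (Submodule.smul_of_tower_mem _ _ (hmem _ (by simp [quartics]))))
        (Submodule.smul_of_tower_mem _ _ (hmem _ (by simp [quartics])))
    have hfg : f - g ∈ idealI k := by
      rw [mem_idealI_iff]
      intro p q i hpq
      simp only [hg, map_sub, map_add, map_smul, toricCoeff_mono, smul_eq_mul]
      by_cases hs : supportI3 p q i
      · rw [h p q i hs]
        unfold supportI3 at hs
        rw [if_neg (by omega), if_neg (by omega), if_neg (by omega)]
        simp
      · unfold supportI3 at hs
        unfold supportI at hpq
        obtain ⟨rfl, rfl, rfl | rfl | rfl⟩ :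
          p = 2 ∧ q = 2 ∧ (i = 0 ∨ i = 2 ∨ i = 4) := by omega
        all_goals simp
    simpa using add_mem (idealI_le_idealI3 hfg) hgmem

/-! ### Socles -/

theorem X_zero_eq_mono : (X 0 : MvPolynomial (Fin 4) k) = mono k 1 0 0 0 := by simp [mono]

theorem X_one_eq_mono : (X 1 : MvPolynomial (Fin 4) k) = mono k 0 1 0 0 := by simp [mono]

theorem X_two_eq_mono : (X 2 : MvPolynomial (Fin 4) k) = mono k 0 0 1 0 := by simp [mono]

theorem X_three_eq_mono : (X 3 : MvPolynomial (Fin 4) k) = mono k 0 0 0 1 := by simp [mono]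

theorem mono_zero : mono k 0 0 0 0 = 1 := by simp [mono]

theorem finite_quotient {J : Ideal (MvPolynomial (Fin 4) k)} (hJ : idealI k ≤ J) :
    Module.Finite k (MvPolynomial (Fin 4) k ⧸ J) := by
  have h : Module.Finite k (MvPolynomial (Fin 4) k ⧸ idealI k) := by
    refine ⟨Submodule.fg_def.mpr ⟨(fun t : ℕ × ℕ × ℕ =>
      Ideal.Quotient.mk (idealI k) (normalMono k t.1 t.2.1 t.2.2)) ''
      (Finset.range 3 ×ˢ Finset.range 3 ×ˢ Finset.range 5 : Finset _),
      (Finset.finite_toSet _).image _, ?_⟩⟩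
    rw [eq_top_iff]
    rintro b -
    obtain ⟨f, rfl⟩ := Ideal.Quotient.mk_surjective b
    rw [mk_eq_sum_normalMono]
    refine Submodule.sum_mem _ fun p hp => Submodule.sum_mem _ fun q hq =>
      Submodule.sum_mem _ fun i hi => Submodule.smul_mem _ _ (Submodule.subset_span ?_)
    exact ⟨(p, q, i), by simpa using ⟨Finset.mem_range.mp hp, Finset.mem_range.mp hq,
      Finset.mem_range.mp hi⟩, rfl⟩
  exact Module.Finite.of_surjective (Ideal.Quotient.factorₐ k hJ).toLinearMap
    (Ideal.Quotient.factor_surjective hJ)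

theorem isArtinianRing_quotient {J : Ideal (MvPolynomial (Fin 4) k)} (hJ : idealI k ≤ J) :
    IsArtinianRing (MvPolynomial (Fin 4) k ⧸ J) :=
  have := finite_quotient hJ
  IsArtinianRing.of_finite k _

/-- The constant coefficient is `toricCoeff k 0 0 0`; the rest of a polynomial is nilpotent modulo
every ideal containing `idealI`. -/
theorem isNilpotent_mk_sub_toricCoeff {J : Ideal (MvPolynomial (Fin 4) k)} (hJ : idealI k ≤ J)
    (f : MvPolynomial (Fin 4) k) :
    IsNilpotent (Ideal.Quotient.mk J (f - C (toricCoeff k 0 0 0 f))) := by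
  induction f using induction_on_mono with
  | add f g hf hg =>
    have h : f + g - C (toricCoeff k 0 0 0 (f + g)) =
        (f - C (toricCoeff k 0 0 0 f)) + (g - C (toricCoeff k 0 0 0 g)) := by
      simp only [map_add]; ring
    rw [h, map_add]
    exact (Commute.all _ _).isNilpotent_add hf hg
  | smul_mono r a b c d =>
    by_cases h : a + b + c + d = 0
    · obtain ⟨rfl, rfl, rfl, rfl⟩ : a = 0 ∧ b = 0 ∧ c = 0 ∧ d = 0 := by omega
      rw [map_smul, toricCoeff_mono, mono_zero, smul_eq_C_mul]
      simp
    · rw [map_smul, toricCoeff_mono, if_neg (by omega), smul_zero, map_zero, sub_zero]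
      refine ⟨3, ?_⟩
      rw [← map_pow, Ideal.Quotient.eq_zero_iff_mem, smul_pow]
      refine hJ (Submodule.smul_of_tower_mem _ _ ?_)
      have h3 : mono k a b c d ^ 3 = mono k (a * 3) (b * 3) (c * 3) (d * 3) := by
        simp only [mono, mul_pow, pow_mul]
      rw [h3]
      exact mono_mem_idealI (by omega)

theorem isUnit_mk_of_toricCoeff_ne_zero {J : Ideal (MvPolynomial (Fin 4) k)} (hJ : idealI k ≤ J)
    {f : MvPolynomial (Fin 4) k} (hf : toricCoeff k 0 0 0 f ≠ 0) :
    IsUnit (Ideal.Quotient.mk J f) := by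
  have h := (isNilpotent_mk_sub_toricCoeff hJ f).isUnit_add_left_of_commute
    (u := Ideal.Quotient.mk J (C (toricCoeff k 0 0 0 f)))
    (((isUnit_iff_ne_zero.mpr hf).map C).map _) (Commute.all _ _)
  rwa [← map_add, add_sub_cancel] at h

theorem isLocalRing_quotient {J : Ideal (MvPolynomial (Fin 4) k)} (hJ : idealI k ≤ J)
    (hJ' : J ≠ ⊤) : IsLocalRing (MvPolynomial (Fin 4) k ⧸ J) := by
  have : Nontrivial (MvPolynomial (Fin 4) k ⧸ J) := Ideal.Quotient.nontrivial_iff.mpr hJ'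
  refine IsLocalRing.of_isUnit_or_isUnit_one_sub_self fun b => ?_
  obtain ⟨f, rfl⟩ := Ideal.Quotient.mk_surjective b
  by_cases hf : toricCoeff k 0 0 0 f = 0
  · right
    rw [← map_one (Ideal.Quotient.mk J), ← map_sub]
    refine isUnit_mk_of_toricCoeff_ne_zero hJ ?_
    rw [map_sub, hf, ← mono_zero, toricCoeff_mono]
    simp
  · exact Or.inl (isUnit_mk_of_toricCoeff_ne_zero hJ hf)

theorem X_mul_mem_of_mk_mem_socle {J : Ideal (MvPolynomial (Fin 4) k)} (hJ : idealI k ≤ J)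
    [IsLocalRing (MvPolynomial (Fin 4) k ⧸ J)] {f : MvPolynomial (Fin 4) k}
    (hf : Ideal.Quotient.mk J f ∈ socle (MvPolynomial (Fin 4) k ⧸ J)) (i : Fin 4) :
    X i * f ∈ J := by
  rw [socle, Submodule.mem_annihilator] at hf
  rw [← Ideal.Quotient.eq_zero_iff_mem, map_mul, mul_comm]
  refine hf _ ((IsLocalRing.mem_maximalIdeal _).mpr ?_)
  have h := isNilpotent_mk_sub_toricCoeff hJ (X i)
  have h0 : toricCoeff k 0 0 0 (X i) = 0 := by
    fin_cases i
    · exact (congrArg _ X_zero_eq_mono).trans (by rw [toricCoeff_mono, if_neg (by omega)])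
    · exact (congrArg _ X_one_eq_mono).trans (by rw [toricCoeff_mono, if_neg (by omega)])
    · exact (congrArg _ X_two_eq_mono).trans (by rw [toricCoeff_mono, if_neg (by omega)])
    · exact (congrArg _ X_three_eq_mono).trans (by rw [toricCoeff_mono, if_neg (by omega)])
  rw [h0, map_zero, sub_zero] at h
  exact h.not_isUnit

theorem mk_mem_socle {J : Ideal (MvPolynomial (Fin 4) k)} (hJ : idealI k ≤ J)
    [IsLocalRing (MvPolynomial (Fin 4) k ⧸ J)] {f : MvPolynomial (Fin 4) k}
    (hf : ∀ i, X i * f ∈ J) : Ideal.Quotient.mk J f ∈ socle (MvPolynomial (Fin 4) k ⧸ J) := by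
  have key (g : MvPolynomial (Fin 4) k) : (g - C (toricCoeff k 0 0 0 g)) * f ∈ J := by
    induction g using induction_on_mono with
    | add g g' hg hg' =>
      convert add_mem hg hg' using 1
      simp only [map_add]; ring
    | smul_mono r a b c d =>
      by_cases h : a + b + c + d = 0
      · obtain ⟨rfl, rfl, rfl, rfl⟩ : a = 0 ∧ b = 0 ∧ c = 0 ∧ d = 0 := by omega
        rw [map_smul, toricCoeff_mono, mono_zero, smul_eq_C_mul]
        simp
      · rw [map_smul, toricCoeff_mono, if_neg (by omega), smul_zero, map_zero, sub_zero,
          smul_mul_assoc]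
        refine Submodule.smul_of_tower_mem _ _ ?_
        have hdvd : ∃ i, X i ∣ mono k a b c d := by
          rcases (by omega : a ≠ 0 ∨ b ≠ 0 ∨ c ≠ 0 ∨ d ≠ 0) with h | h | h | h
          · exact ⟨0, (((dvd_pow_self _ h).mul_right _).mul_right _).mul_right _⟩
          · exact ⟨1, (((dvd_pow_self _ h).mul_left _).mul_right _).mul_right _⟩
          · exact ⟨2, ((dvd_pow_self _ h).mul_left _).mul_right _⟩
          · exact ⟨3, (dvd_pow_self _ h).mul_left _⟩
        obtain ⟨i, u, hu⟩ := hdvd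
        rw [hu, mul_right_comm]
        exact J.mul_mem_right _ (hf i)
  rw [socle, Submodule.mem_annihilator]
  intro b hb
  obtain ⟨g, rfl⟩ := Ideal.Quotient.mk_surjective b
  have hg : toricCoeff k 0 0 0 g = 0 := by
    by_contra h
    exact (IsLocalRing.mem_maximalIdeal _).mp hb (isUnit_mk_of_toricCoeff_ne_zero hJ h)
  have h := key g
  rw [hg, map_zero, sub_zero] at h
  rw [smul_eq_mul, ← map_mul, mul_comm, Ideal.Quotient.eq_zero_iff_mem]
  exact h

/-- If `f` is killed by the variables modulo the ideal given by `K`, its coefficient at `aᵖ b^q sⁱ`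
vanishes as soon as one of the four multiples of `aᵖ b^q sⁱ` by a variable lies in `K`. -/
theorem toricCoeff_eq_zero_of_X_mul {J : Ideal (MvPolynomial (Fin 4) k)} {K : ℕ → ℕ → ℕ → Prop}
    (hJK : ∀ f ∈ J, ∀ p q i, K p q i → toricCoeff k p q i f = 0) {f : MvPolynomial (Fin 4) k}
    (hf : ∀ i, X i * f ∈ J) {p q i : ℕ} (h : K (p + 1) q (i + 1) ∨ K (p + 1) q i ∨
      K p (q + 1) i ∨ K p (q + 1) (i + 1)) : toricCoeff k p q i f = 0 := by
  rcases h with h | h | h | h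
  · simpa [X_zero_eq_mono, toricCoeff_mono_mul] using hJK _ (hf 0) _ _ _ h
  · simpa [X_one_eq_mono, toricCoeff_mono_mul] using hJK _ (hf 1) _ _ _ h
  · simpa [X_two_eq_mono, toricCoeff_mono_mul] using hJK _ (hf 2) _ _ _ h
  · simpa [X_three_eq_mono, toricCoeff_mono_mul] using hJK _ (hf 3) _ _ _ h

/-- If `J` is given by the vanishing of the coefficients in `K`, and every element of `K` outside
the bidegree `(2, 2)` can be multiplied by a variable inside `K`, then the socle of `S / J` has as basis
the elements of `K` in bidegree `(2, 2)`: these are listed by `idx`, with representatives `m`. -/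
theorem socle_eq_and_finrank {J : Ideal (MvPolynomial (Fin 4) k)} {K : ℕ → ℕ → ℕ → Prop}
    (hJ : idealI k ≤ J) [IsLocalRing (MvPolynomial (Fin 4) k ⧸ J)]
    (hJK : ∀ f, f ∈ J ↔ ∀ p q i, K p q i → toricCoeff k p q i f = 0)
    (hsucc : ∀ p q i, K p q i → ¬ (p = 2 ∧ q = 2) → i ≤ p + q →
      K (p + 1) q (i + 1) ∨ K (p + 1) q i ∨ K p (q + 1) i ∨ K p (q + 1) (i + 1))
    {n : ℕ} (idx : Fin n → ℕ) (hinj : Function.Injective idx) (hidx : ∀ t, K 2 2 (idx t))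
    (hidx' : ∀ i ≤ 4, K 2 2 i → ∃ t, idx t = i) (m : Fin n → MvPolynomial (Fin 4) k)
    (hm : ∀ t, ∃ a b c d, a + b = 2 ∧ c + d = 2 ∧ a + d = idx t ∧ m t = mono k a b c d) :
    socle (MvPolynomial (Fin 4) k ⧸ J) =
        (Ideal.span (Set.range m)).map (Ideal.Quotient.mk J) ∧
      Module.finrank k (socle (MvPolynomial (Fin 4) k ⧸ J)) = n := by
  have hcoeff (t p q i) : toricCoeff k p q i (m t) =
      if 2 = p ∧ 2 = q ∧ idx t = i then 1 else 0 := by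
    obtain ⟨a, b, c, d, h1, h2, h3, h4⟩ := hm t
    rw [h4, toricCoeff_mono, h1, h2, h3]
  have hmem (t) : Ideal.Quotient.mk J (m t) ∈ socle (MvPolynomial (Fin 4) k ⧸ J) := by
    refine mk_mem_socle hJ fun i => hJ ?_
    obtain ⟨a, b, c, d, h1, h2, -, h4⟩ := hm t
    rw [h4]
    fin_cases i
    · change X 0 * _ ∈ _
      rw [X_zero_eq_mono, mono_mul_mono]
      exact mono_mem_idealI (by omega)
    · change X 1 * _ ∈ _
      rw [X_one_eq_mono, mono_mul_mono]
      exact mono_mem_idealI (by omega)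
    · change X 2 * _ ∈ _
      rw [X_two_eq_mono, mono_mul_mono]
      exact mono_mem_idealI (by omega)
    · change X 3 * _ ∈ _
      rw [X_three_eq_mono, mono_mul_mono]
      exact mono_mem_idealI (by omega)
  let Ψ : (Fin n → k) →ₗ[k] MvPolynomial (Fin 4) k ⧸ J :=
    Fintype.linearCombination k fun t => Ideal.Quotient.mk J (m t)
  have hΨ (c) : Ψ c = Ideal.Quotient.mk J (∑ t, c t • m t) := by
    rw [map_sum]
    exact Fintype.linearCombination_apply _ _ _
  have hsum (c : Fin n → k) (t) : toricCoeff k 2 2 (idx t) (∑ t, c t • m t) = c t := by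
    rw [map_sum, Finset.sum_eq_single_of_mem t (Finset.mem_univ t), map_smul, hcoeff]
    · simp
    · intro t' _ ht'
      rw [map_smul, hcoeff, if_neg (fun h => ht' (hinj h.2.2)), smul_zero]
  have hΨinj : Function.Injective Ψ := by
    rw [← LinearMap.ker_eq_bot, LinearMap.ker_eq_bot']
    intro c hc
    rw [hΨ, Ideal.Quotient.eq_zero_iff_mem, hJK] at hc
    ext t
    rw [← hsum c t, hc _ _ _ (hidx t), Pi.zero_apply]
  have hrange : (socle (MvPolynomial (Fin 4) k ⧸ J)).restrictScalars k = LinearMap.range Ψ := by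
    ext b
    obtain ⟨f, rfl⟩ := Ideal.Quotient.mk_surjective b
    rw [Submodule.restrictScalars_mem, LinearMap.mem_range]
    constructor
    · intro hf
      have hf' := X_mul_mem_of_mk_mem_socle hJ hf
      refine ⟨fun t => toricCoeff k 2 2 (idx t) f, ?_⟩
      rw [hΨ, Ideal.Quotient.mk_eq_mk_iff_sub_mem, hJK]
      intro p q i h
      by_cases hi : p + q < i
      · exact toricCoeff_eq_zero_of_lt hi _
      by_cases hpq : p = 2 ∧ q = 2
      · obtain ⟨rfl, rfl⟩ := hpq
        obtain ⟨t, rfl⟩ := hidx' i (by omega) h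
        rw [map_sub, hsum (fun t => toricCoeff k 2 2 (idx t) f), sub_self]
      · rw [map_sub, toricCoeff_eq_zero_of_X_mul (fun f hf => (hJK f).mp hf) hf'
          (hsucc p q i h hpq (by omega)), map_sum, sub_zero]
        refine Finset.sum_eq_zero fun t _ => ?_
        rw [map_smul, hcoeff, if_neg (by omega), smul_zero]
    · rintro ⟨c, hc⟩
      rw [← hc, hΨ, map_sum]
      exact Submodule.sum_mem _ fun t _ =>
        Submodule.smul_of_tower_mem (socle _) (c t) (hmem t)
  constructor
  · rw [Ideal.map_span, ← Set.range_comp]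
    apply le_antisymm
    · intro b hb
      obtain ⟨c, rfl⟩ : b ∈ LinearMap.range Ψ := hrange ▸ hb
      rw [hΨ, map_sum]
      exact Submodule.sum_mem _ fun t _ =>
        Submodule.smul_of_tower_mem (Ideal.span (Set.range _)) (c t) (Ideal.subset_span ⟨t, rfl⟩)
    · rw [Ideal.span_le]
      rintro _ ⟨t, rfl⟩
      exact hmem t
  · have h : Module.finrank k ((socle (MvPolynomial (Fin 4) k ⧸ J)).restrictScalars k) = n := by
      rw [hrange, LinearMap.finrank_range_of_inj hΨinj, Module.finrank_fin_fun]
    exact h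

theorem idealI3_ne_top : idealI3 k ≠ ⊤ := by
  rw [Ne, Ideal.eq_top_iff_one, mem_idealI3_iff]
  intro h
  have h1 := h 0 0 0 (by simp [supportI3])
  rw [← mono_zero, toricCoeff_mono] at h1
  simp at h1

theorem idealI_ne_top : idealI k ≠ ⊤ := fun h =>
  idealI3_ne_top (top_le_iff.mp (h ▸ idealI_le_idealI3))

theorem socle_idealI [IsLocalRing (MvPolynomial (Fin 4) k ⧸ idealI k)] :
    socle (MvPolynomial (Fin 4) k ⧸ idealI k) =
        (Ideal.span {X 0 ^ 2 * X 2 ^ 2, X 0 ^ 2 * X 2 * X 3, X 0 ^ 2 * X 3 ^ 2,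
          X 0 * X 1 * X 2 ^ 2, X 1 ^ 2 * X 2 ^ 2}).map (Ideal.Quotient.mk (idealI k)) ∧
      Module.finrank k (socle (MvPolynomial (Fin 4) k ⧸ idealI k)) = 5 := by
  have h := socle_eq_and_finrank (le_refl (idealI k)) (fun f => mem_idealI_iff)
    (fun p q i h => by unfold supportI at *; omega) ![0, 1, 4, 3, 2]
    (by decide) (fun t => by simp [supportI])
    (fun i hi _ => by interval_cases i <;> decide)
    ![mono k 0 2 2 0, mono k 1 1 2 0, mono k 2 0 0 2, mono k 2 0 1 1, mono k 2 0 2 0]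
    (fun t => by
      fin_cases t
      · exact ⟨0, 2, 2, 0, rfl, rfl, rfl, rfl⟩
      · exact ⟨1, 1, 2, 0, rfl, rfl, rfl, rfl⟩
      · exact ⟨2, 0, 0, 2, rfl, rfl, rfl, rfl⟩
      · exact ⟨2, 0, 1, 1, rfl, rfl, rfl, rfl⟩
      · exact ⟨2, 0, 2, 0, rfl, rfl, rfl, rfl⟩)
  simpa [mono, Matrix.range_cons] using h

theorem socle_idealI3 [IsLocalRing (MvPolynomial (Fin 4) k ⧸ idealI3 k)] :
    socle (MvPolynomial (Fin 4) k ⧸ idealI3 k) =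
        (Ideal.span {X 0 ^ 2 * X 2 * X 3, X 0 * X 1 * X 2 ^ 2}).map
          (Ideal.Quotient.mk (idealI3 k)) ∧
      Module.finrank k (socle (MvPolynomial (Fin 4) k ⧸ idealI3 k)) = 2 := by
  have h := socle_eq_and_finrank idealI_le_idealI3 (fun f => mem_idealI3_iff)
    (fun p q i h => by unfold supportI3 at *; omega) ![1, 3]
    (by decide) (fun t => by fin_cases t <;> simp [supportI3])
    (fun i hi h => by
      obtain rfl | rfl : i = 1 ∨ i = 3 := by unfold supportI3 at h; omega
      · exact ⟨0, rfl⟩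
      · exact ⟨1, rfl⟩)
    ![mono k 1 1 2 0, mono k 2 0 1 1]
    (fun t => by
      fin_cases t
      · exact ⟨1, 1, 2, 0, rfl, rfl, rfl, rfl⟩
      · exact ⟨2, 0, 1, 1, rfl, rfl, rfl, rfl⟩)
  simpa [mono, Matrix.range_cons] using h

/-! ### The twelve generators and rigidity of their images -/

instance : GradedAlgebra (stdGrading k) :=
  weightedGradedAlgebra k _

/-- The twelve generators of `idealI3`: the cubics in `x, y`, the cubics in `z, w`, the quadric, and
the three quartics. -/
def generator (k : Type*) [Field k] : Fin 12 → MvPolynomial (Fin 4) k :=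
  ![mono k 3 0 0 0, mono k 2 1 0 0, mono k 1 2 0 0, mono k 0 3 0 0,
    mono k 0 0 3 0, mono k 0 0 2 1, mono k 0 0 1 2, mono k 0 0 0 3,
    mono k 1 0 1 0 - mono k 0 1 0 1,
    mono k 2 0 2 0, mono k 2 0 0 2, mono k 0 2 2 0]

/-- The degrees of the twelve generators. -/
def generatorDegree : Fin 12 → ℤ :=
  ![3, 3, 3, 3, 3, 3, 3, 3, 2, 4, 4, 4]

theorem generator_mem_stdGrading (i : Fin 12) :
    generator k i ∈ stdGrading k (generatorDegree i) := by
  fin_cases i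
  on_goal 9 => exact sub_mem (mono_mem_stdGrading 1 0 1 0) (mono_mem_stdGrading 0 1 0 1)
  all_goals exact mono_mem_stdGrading _ _ _ _

theorem range_generator : Set.range (generator k) = cubicsAndQuadric k ∪ quartics k := by
  ext f
  simp only [generator, cubicsAndQuadric, quartics, Set.mem_range, Set.mem_union,
    Set.mem_insert_iff, Set.mem_singleton_iff, Fin.exists_fin_succ, or_assoc]
  simp [eq_comm]

/-- The twelve standard generators of `idealI3` as a graded surjection from a free module. -/
def standardGenerators (k : Type*) [Field k] :
    HomogeneousGenerators (stdGrading k) (idealI3 k) (Fin 12) where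
  gen := generator k
  deg := generatorDegree
  gen_mem := generator_mem_stdGrading
  span_range_gen := by rw [range_generator, idealI3_eq_span]

/-- Four sequences of length three vanish if each of the first three begins with `0` and continues
with the next one. -/
theorem eq_zero_of_shift {g₀ g₁ g₂ g₃ : ℕ → k}
    (h0 : g₀ 0 = 0 ∧ ∀ i, g₀ (i + 1) = g₁ i) (h1 : g₁ 0 = 0 ∧ ∀ i, g₁ (i + 1) = g₂ i)
    (h2 : g₂ 0 = 0 ∧ ∀ i, g₂ (i + 1) = g₃ i)
    (hlen : ∀ i ≥ 3, g₀ i = 0 ∧ g₁ i = 0 ∧ g₂ i = 0 ∧ g₃ i = 0) :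
    g₀ = 0 ∧ g₁ = 0 ∧ g₂ = 0 ∧ g₃ = 0 := by
  have hg3 : g₃ = 0 := by
    ext i
    rw [← h2.2, ← h1.2, ← h0.2]
    exact (hlen _ (by omega)).1
  have hg2 : g₂ = 0 := by
    ext i
    cases i with
    | zero => exact h2.1
    | succ i => rw [h2.2, hg3]; rfl
  have hg1 : g₁ = 0 := by
    ext i
    cases i with
    | zero => exact h1.1
    | succ i => rw [h1.2, hg2]; rfl
  have hg0 : g₀ = 0 := by
    ext i
    cases i with
    | zero => exact h0.1
    | succ i => rw [h0.2, hg1]; rfl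
  exact ⟨hg0, hg1, hg2, hg3⟩

section

variable {H : Fin 12 → MvPolynomial (Fin 4) k}

/-- The images `H i` of the generators satisfy every relation `a gᵢ = b gₗ`. -/
theorem mul_sub_mul_mem_of_relation
    (hrel : ∀ r, Fintype.linearCombination (MvPolynomial (Fin 4) k) (generator k) r = 0 →
      Fintype.linearCombination (MvPolynomial (Fin 4) k) H r ∈ idealI3 k)
    {i l : Fin 12} {a b : MvPolynomial (Fin 4) k} (h : a * generator k i = b * generator k l) :
    a * H i - b * H l ∈ idealI3 k := by
  have := hrel (Pi.single i a - Pi.single l b) (by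
    rw [map_sub, Fintype.linearCombination_apply_single, Fintype.linearCombination_apply_single,
      smul_eq_mul, smul_eq_mul, h, sub_self])
  rwa [map_sub, Fintype.linearCombination_apply_single, Fintype.linearCombination_apply_single]
    at this

theorem mul_sub_sub_mul_mem_of_relation
    (hrel : ∀ r, Fintype.linearCombination (MvPolynomial (Fin 4) k) (generator k) r = 0 →
      Fintype.linearCombination (MvPolynomial (Fin 4) k) H r ∈ idealI3 k)
    {i l m : Fin 12} {a b c : MvPolynomial (Fin 4) k}
    (h : a * generator k i - b * generator k l = c * generator k m) :
    a * H i - b * H l - c * H m ∈ idealI3 k := by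
  have := hrel (Pi.single i a - Pi.single l b - Pi.single m c) (by
    rw [map_sub, map_sub, Fintype.linearCombination_apply_single,
      Fintype.linearCombination_apply_single, Fintype.linearCombination_apply_single,
      smul_eq_mul, smul_eq_mul, smul_eq_mul, h, sub_self])
  rwa [map_sub, map_sub, Fintype.linearCombination_apply_single,
    Fintype.linearCombination_apply_single, Fintype.linearCombination_apply_single]
    at this

/-- In toric coordinates, `y f = x g` says that `f = s g`. -/
theorem shift_of_xy {f g : MvPolynomial (Fin 4) k} (h : X 1 * f - X 0 * g ∈ idealI3 k) {p q : ℕ}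
    (hs : ∀ i, supportI3 (p + 1) q i) :
    toricCoeff k p q 0 f = 0 ∧ ∀ i, toricCoeff k p q (i + 1) f = toricCoeff k p q i g := by
  rw [mem_idealI3_iff, X_zero_eq_mono, X_one_eq_mono] at h
  simp only [map_sub, toricCoeff_mono_mul] at h
  exact ⟨by simpa using h _ _ 0 (hs 0), fun i => by simpa [sub_eq_zero] using h _ _ (i + 1) (hs _)⟩

/-- In toric coordinates, `z f = w g` says that `f = s g`. -/
theorem shift_of_zw {f g : MvPolynomial (Fin 4) k} (h : X 2 * f - X 3 * g ∈ idealI3 k) {p q : ℕ}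
    (hs : ∀ i, supportI3 p (q + 1) i) :
    toricCoeff k p q 0 f = 0 ∧ ∀ i, toricCoeff k p q (i + 1) f = toricCoeff k p q i g := by
  rw [mem_idealI3_iff, X_two_eq_mono, X_three_eq_mono] at h
  simp only [map_sub, toricCoeff_mono_mul] at h
  exact ⟨by simpa using h _ _ 0 (hs 0), fun i => by simpa [sub_eq_zero] using h _ _ (i + 1) (hs _)⟩

/-- In `S / idealI3` there are no nonzero `g₀, g₁, g₂, g₃` of degree at most two that form a
geometric progression of ratio `y / x = z / w`. -/
theorem mem_idealI3_of_progression {g₀ g₁ g₂ g₃ : MvPolynomial (Fin 4) k}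
    (hxy : X 1 * g₀ - X 0 * g₁ ∈ idealI3 k ∧ X 1 * g₁ - X 0 * g₂ ∈ idealI3 k ∧
      X 1 * g₂ - X 0 * g₃ ∈ idealI3 k)
    (hzw : X 2 * g₀ - X 3 * g₁ ∈ idealI3 k ∧ X 2 * g₁ - X 3 * g₂ ∈ idealI3 k ∧
      X 2 * g₂ - X 3 * g₃ ∈ idealI3 k)
    (hdeg : ∀ p q i, 3 ≤ p + q → toricCoeff k p q i g₀ = 0 ∧ toricCoeff k p q i g₁ = 0 ∧
      toricCoeff k p q i g₂ = 0 ∧ toricCoeff k p q i g₃ = 0) :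
    g₀ ∈ idealI3 k ∧ g₁ ∈ idealI3 k ∧ g₂ ∈ idealI3 k ∧ g₃ ∈ idealI3 k := by
  have key (p q i : ℕ) : toricCoeff k p q i g₀ = 0 ∧ toricCoeff k p q i g₁ = 0 ∧
      toricCoeff k p q i g₂ = 0 ∧ toricCoeff k p q i g₃ = 0 := by
    by_cases hpq : 3 ≤ p + q
    · exact hdeg p q i hpq
    have hlen : ∀ i ≥ 3, toricCoeff k p q i g₀ = 0 ∧ toricCoeff k p q i g₁ = 0 ∧
        toricCoeff k p q i g₂ = 0 ∧ toricCoeff k p q i g₃ = 0 := fun i hi =>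
      ⟨toricCoeff_eq_zero_of_lt (by omega) _, toricCoeff_eq_zero_of_lt (by omega) _,
        toricCoeff_eq_zero_of_lt (by omega) _, toricCoeff_eq_zero_of_lt (by omega) _⟩
    obtain ⟨e0, e1, e2, e3⟩ : _ ∧ _ ∧ _ ∧ _ := by
      -- multiplication by `x` and `y` is injective on bidegrees `(p, q)` with `p ≤ 1` and
      -- `p + q ≤ 2`, multiplication by `z` and `w` on the remaining bidegree `(2, 0)`
      by_cases hp : p ≤ 1
      · have hs i : supportI3 (p + 1) q i := by unfold supportI3; omega
        exact eq_zero_of_shift (shift_of_xy hxy.1 hs) (shift_of_xy hxy.2.1 hs)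
          (shift_of_xy hxy.2.2 hs) hlen
      · have hs i : supportI3 p (q + 1) i := by unfold supportI3; omega
        exact eq_zero_of_shift (shift_of_zw hzw.1 hs) (shift_of_zw hzw.2.1 hs)
          (shift_of_zw hzw.2.2 hs) hlen
    exact ⟨congrFun e0 i, congrFun e1 i, congrFun e2 i, congrFun e3 i⟩
  simp only [mem_idealI3_iff]
  exact ⟨fun p q i _ => (key p q i).1, fun p q i _ => (key p q i).2.1,
    fun p q i _ => (key p q i).2.2.1, fun p q i _ => (key p q i).2.2.2⟩

/-- An element of degree at most three that is killed by the variables is zero in `S / idealI3`. -/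
theorem mem_idealI3_of_X_mul {f : MvPolynomial (Fin 4) k} (hf : ∀ i, X i * f ∈ idealI3 k)
    (hdeg : ∀ p q i, 4 ≤ p + q → toricCoeff k p q i f = 0) : f ∈ idealI3 k := by
  rw [mem_idealI3_iff]
  intro p q i h
  by_cases hpq : 4 ≤ p + q
  · exact hdeg p q i hpq
  by_cases hi : p + q < i
  · exact toricCoeff_eq_zero_of_lt hi _
  · exact toricCoeff_eq_zero_of_X_mul (fun f hf => mem_idealI3_iff.mp hf) hf (by
      unfold supportI3 at *; omega)

theorem mem_of_sub_mem {f g : MvPolynomial (Fin 4) k} {a b : MvPolynomial (Fin 4) k}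
    (h : a * f - b * g ∈ idealI3 k) (hg : g ∈ idealI3 k) : a * f ∈ idealI3 k := by
  simpa using add_mem h ((idealI3 k).mul_mem_left b hg)

/-- The rigidity behind `T¹` in negative degrees: a homomorphism `idealI3 → S / idealI3` of negative
degree that sends the quadric to an element without linear part is zero. The homomorphism is given
by representatives `H i` of the images of the generators. -/
theorem mem_idealI3_of_relations
    (hrel : ∀ r, Fintype.linearCombination (MvPolynomial (Fin 4) k) (generator k) r = 0 →
      Fintype.linearCombination (MvPolynomial (Fin 4) k) H r ∈ idealI3 k)
    (hdeg : ∀ n (p q i : ℕ), generatorDegree n ≤ p + q → toricCoeff k p q i (H n) = 0)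
    (hlin : ∀ p q i, p + q = 1 → toricCoeff k p q i (H 8) = 0) (n : Fin 12) :
    H n ∈ idealI3 k := by
  have R2 {i l : Fin 12} {a b : MvPolynomial (Fin 4) k} := mul_sub_mul_mem_of_relation
    (H := H) hrel (i := i) (l := l) (a := a) (b := b)
  have R3 {i l m : Fin 12} {a b : MvPolynomial (Fin 4) k} (c : MvPolynomial (Fin 4) k) :=
    mul_sub_sub_mul_mem_of_relation (H := H) hrel (i := i) (l := l) (m := m) (a := a) (b := b)
      (c := c)
  have hconst : toricCoeff k 0 0 0 (H 8) = 0 := by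
    have h := R3 (i := 0) (l := 1) (m := 8) (a := X 2) (b := X 3) (mono k 2 0 0 0) (by
      change X 2 * mono k 3 0 0 0 - X 3 * mono k 2 1 0 0 =
        mono k 2 0 0 0 * (mono k 1 0 1 0 - mono k 0 1 0 1)
      simp only [mono]; ring)
    have h' := mem_idealI3_iff.mp h 2 0 2 (by simp [supportI3])
    rw [X_two_eq_mono, X_three_eq_mono] at h'
    simpa [toricCoeff_mono_mul] using h'
  have h8 : H 8 ∈ idealI3 k := by
    rw [mem_idealI3_iff]
    intro p q i _
    by_cases h : 2 ≤ p + q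
    · exact hdeg 8 p q i (by change (2 : ℤ) ≤ _; omega)
    by_cases h1 : p + q = 1
    · exact hlin _ _ _ h1
    obtain ⟨rfl, rfl⟩ : p = 0 ∧ q = 0 := by omega
    rcases Nat.eq_zero_or_pos i with rfl | hi
    · exact hconst
    · exact toricCoeff_eq_zero_of_lt (by omega) _
  have R3' {i l : Fin 12} {a b : MvPolynomial (Fin 4) k} (c : MvPolynomial (Fin 4) k)
      (h : a * generator k i - b * generator k l = c * generator k 8) :
      a * H i - b * H l ∈ idealI3 k := by
    simpa using add_mem (R3 c h) ((idealI3 k).mul_mem_left c h8)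
  have hcube (n : Fin 12) (hn : generatorDegree n = 3) (p q i : ℕ) (h : 3 ≤ p + q) :
    toricCoeff k p q i (H n) = 0 := hdeg n p q i (by omega)
  obtain ⟨h0, h1, h2, h3⟩ := mem_idealI3_of_progression
    (g₀ := H 0) (g₁ := H 1) (g₂ := H 2) (g₃ := H 3)
    ⟨R2 (i := 0) (l := 1)
        (show X 1 * mono k 3 0 0 0 = X 0 * mono k 2 1 0 0 by simp only [mono]; ring),
      R2 (i := 1) (l := 2)
        (show X 1 * mono k 2 1 0 0 = X 0 * mono k 1 2 0 0 by simp only [mono]; ring),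
      R2 (i := 2) (l := 3)
        (show X 1 * mono k 1 2 0 0 = X 0 * mono k 0 3 0 0 by simp only [mono]; ring)⟩
    ⟨R3' (mono k 2 0 0 0) (i := 0) (l := 1) (show X 2 * mono k 3 0 0 0 - X 3 * mono k 2 1 0 0 =
        mono k 2 0 0 0 * (mono k 1 0 1 0 - mono k 0 1 0 1) by simp only [mono]; ring),
      R3' (mono k 1 1 0 0) (i := 1) (l := 2) (show X 2 * mono k 2 1 0 0 - X 3 * mono k 1 2 0 0 =
        mono k 1 1 0 0 * (mono k 1 0 1 0 - mono k 0 1 0 1) by simp only [mono]; ring),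
      R3' (mono k 0 2 0 0) (i := 2) (l := 3) (show X 2 * mono k 1 2 0 0 - X 3 * mono k 0 3 0 0 =
        mono k 0 2 0 0 * (mono k 1 0 1 0 - mono k 0 1 0 1) by simp only [mono]; ring)⟩
    (fun p q i h => ⟨hcube 0 rfl p q i h, hcube 1 rfl p q i h, hcube 2 rfl p q i h,
      hcube 3 rfl p q i h⟩)
  -- the cubics in `z, w` form a progression of the same ratio in the opposite order
  obtain ⟨h7, h6, h5, h4⟩ := mem_idealI3_of_progression
    (g₀ := H 7) (g₁ := H 6) (g₂ := H 5) (g₃ := H 4)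
    ⟨R3' (-mono k 0 0 0 2) (i := 7) (l := 6) (show X 1 * mono k 0 0 0 3 - X 0 * mono k 0 0 1 2 =
        -mono k 0 0 0 2 * (mono k 1 0 1 0 - mono k 0 1 0 1) by simp only [mono]; ring),
      R3' (-mono k 0 0 1 1) (i := 6) (l := 5) (show X 1 * mono k 0 0 1 2 - X 0 * mono k 0 0 2 1 =
        -mono k 0 0 1 1 * (mono k 1 0 1 0 - mono k 0 1 0 1) by simp only [mono]; ring),
      R3' (-mono k 0 0 2 0) (i := 5) (l := 4) (show X 1 * mono k 0 0 2 1 - X 0 * mono k 0 0 3 0 =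
        -mono k 0 0 2 0 * (mono k 1 0 1 0 - mono k 0 1 0 1) by simp only [mono]; ring)⟩
    ⟨R2 (i := 7) (l := 6)
        (show X 2 * mono k 0 0 0 3 = X 3 * mono k 0 0 1 2 by simp only [mono]; ring),
      R2 (i := 6) (l := 5)
        (show X 2 * mono k 0 0 1 2 = X 3 * mono k 0 0 2 1 by simp only [mono]; ring),
      R2 (i := 5) (l := 4)
        (show X 2 * mono k 0 0 2 1 = X 3 * mono k 0 0 3 0 by simp only [mono]; ring)⟩
    (fun p q i h => ⟨hcube 7 rfl p q i h, hcube 6 rfl p q i h, hcube 5 rfl p q i h,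
      hcube 4 rfl p q i h⟩)
  have hquartic (n : Fin 12) (hn : generatorDegree n = 4) (hx : X 0 * H n ∈ idealI3 k)
      (hy : X 1 * H n ∈ idealI3 k) (hz : X 2 * H n ∈ idealI3 k) (hw : X 3 * H n ∈ idealI3 k) :
      H n ∈ idealI3 k :=
    mem_idealI3_of_X_mul (fun i => by fin_cases i; exacts [hx, hy, hz, hw])
      fun p q i h => hdeg n p q i (by omega)
  have h9 : H 9 ∈ idealI3 k := by
    refine hquartic 9 rfl ?_ ?_ ?_ ?_
    · exact mem_of_sub_mem (R2 (i := 9) (l := 0)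
        (show X 0 * mono k 2 0 2 0 = mono k 0 0 2 0 * mono k 3 0 0 0 by
        simp only [mono]; ring)) h0
    · exact mem_of_sub_mem (R2 (i := 9) (l := 1)
        (show X 1 * mono k 2 0 2 0 = mono k 0 0 2 0 * mono k 2 1 0 0 by
        simp only [mono]; ring)) h1
    · exact mem_of_sub_mem (R2 (i := 9) (l := 4)
        (show X 2 * mono k 2 0 2 0 = mono k 2 0 0 0 * mono k 0 0 3 0 by
        simp only [mono]; ring)) h4
    · exact mem_of_sub_mem (R2 (i := 9) (l := 5)
        (show X 3 * mono k 2 0 2 0 = mono k 2 0 0 0 * mono k 0 0 2 1 by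
        simp only [mono]; ring)) h5
  have h10 : H 10 ∈ idealI3 k := by
    refine hquartic 10 rfl ?_ ?_ ?_ ?_
    · exact mem_of_sub_mem (R2 (i := 10) (l := 0)
        (show X 0 * mono k 2 0 0 2 = mono k 0 0 0 2 * mono k 3 0 0 0 by
        simp only [mono]; ring)) h0
    · exact mem_of_sub_mem (R2 (i := 10) (l := 1)
        (show X 1 * mono k 2 0 0 2 = mono k 0 0 0 2 * mono k 2 1 0 0 by
        simp only [mono]; ring)) h1
    · exact mem_of_sub_mem (R2 (i := 10) (l := 6)
        (show X 2 * mono k 2 0 0 2 = mono k 2 0 0 0 * mono k 0 0 1 2 by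
        simp only [mono]; ring)) h6
    · exact mem_of_sub_mem (R2 (i := 10) (l := 7)
        (show X 3 * mono k 2 0 0 2 = mono k 2 0 0 0 * mono k 0 0 0 3 by
        simp only [mono]; ring)) h7
  have h11 : H 11 ∈ idealI3 k := by
    refine hquartic 11 rfl ?_ ?_ ?_ ?_
    · exact mem_of_sub_mem (R2 (i := 11) (l := 2)
        (show X 0 * mono k 0 2 2 0 = mono k 0 0 2 0 * mono k 1 2 0 0 by
        simp only [mono]; ring)) h2
    · exact mem_of_sub_mem (R2 (i := 11) (l := 3)
        (show X 1 * mono k 0 2 2 0 = mono k 0 0 2 0 * mono k 0 3 0 0 by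
        simp only [mono]; ring)) h3
    · exact mem_of_sub_mem (R2 (i := 11) (l := 4)
        (show X 2 * mono k 0 2 2 0 = mono k 0 2 0 0 * mono k 0 0 3 0 by
        simp only [mono]; ring)) h4
    · exact mem_of_sub_mem (R2 (i := 11) (l := 5)
        (show X 3 * mono k 0 2 2 0 = mono k 0 2 0 0 * mono k 0 0 2 1 by
        simp only [mono]; ring)) h5
  fin_cases n
  exacts [h0, h1, h2, h3, h4, h5, h6, h7, h8, h9, h10, h11]

end

/-! ### Tangents of negative degree -/

theorem toricCoeff_pderiv_eq_zero {f : MvPolynomial (Fin 4) k} {m : ℤ} (hf : f ∈ stdGrading k m)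
    (u : Fin 4) {p q i : ℕ} (h : m ≤ p + q) : toricCoeff k p q i (pderiv u f) = 0 := by
  have hd : pderiv u f ∈ stdGrading k (m - 1) :=
    IsWeightedHomogeneous.pderiv (w := fun _ => (1 : ℤ)) hf (by simp)
  exact toricCoeff_eq_zero_of_mem_stdGrading hd (by omega)

/-- The derivation of `k[x,y,z,w]` with constant coefficients `c`. -/
def constDerivation (c : Fin 4 → k) :
    Derivation k (MvPolynomial (Fin 4) k) (MvPolynomial (Fin 4) k) :=
  ∑ u, c u • pderiv u

theorem constDerivation_apply (c : Fin 4 → k) (f : MvPolynomial (Fin 4) k) :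
    constDerivation c f = ∑ u, c u • pderiv u f := by
  rw [constDerivation, Fin.sum_univ_four, Fin.sum_univ_four]
  rfl

theorem constDerivation_quadric (c : Fin 4 → k) :
    constDerivation c (generator k 8) =
      c 0 • mono k 0 0 1 0 - c 1 • mono k 0 0 0 1 + c 2 • mono k 1 0 0 0
        - c 3 • mono k 0 1 0 0 := by
  have h : generator k 8 = X 0 * X 2 - X 1 * X 3 := by
    change mono k 1 0 1 0 - mono k 0 1 0 1 = _
    simp [mono]
  rw [h, constDerivation_apply, Fin.sum_univ_four]
  simp [mono, pderiv_X]
  ring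

theorem T1Piece_eq_bot_of_neg {ι : Type*} [Fintype ι]
    (P : HomogeneousGenerators (stdGrading k) (idealI3 k) ι) {j : ℤ} (hj : j < 0) :
    P.T1Piece j = ⊥ := by
  refine HomogeneousGenerators.T1Piece_eq_bot (standardGenerators k) P j fun h hh hrel => ?_
  choose H hH hHh using hh
  obtain rfl : (fun i => Ideal.Quotient.mk (idealI3 k) (H i)) = h := funext hHh
  -- a derivation `∑ c_u ∂_u` sends `xz - yw` to `c₀ z - c₁ w + c₂ x - c₃ y`; this fixes the `c_u`
  set D := constDerivation ![toricCoeff k 0 1 0 (H 8), -toricCoeff k 0 1 1 (H 8),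
    toricCoeff k 1 0 1 (H 8), -toricCoeff k 1 0 0 (H 8)] with hD
  have hH0 (n : Fin 12) (p q i : ℕ) (hn : generatorDegree n ≤ p + q) :
      toricCoeff k p q i (H n) = 0 :=
    toricCoeff_eq_zero_of_mem_stdGrading (hH n) (by
      change (_ : ℤ) ≠ generatorDegree n + j
      omega)
  refine ⟨(Ideal.Quotient.mkₐ (MvPolynomial (Fin 4) k) (idealI3 k)).toLinearMap.compDer D,
    fun n => ?_⟩
  refine (Ideal.Quotient.mk_eq_mk_iff_sub_mem _ _).mpr ?_
  refine mem_idealI3_of_relations (H := fun n => H n - D (generator k n)) ?_ ?_ ?_ n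
  · intro r hr
    have h1 : Fintype.linearCombination (MvPolynomial (Fin 4) k) H r ∈ idealI3 k := by
      rw [← Ideal.Quotient.eq_zero_iff_mem, Fintype.linearCombination_apply, map_sum]
      exact hrel r hr
    -- `∑ r_n D g_n = -∑ g_n D r_n`, as `∑ r_n g_n = 0`
    have h2 : Fintype.linearCombination (MvPolynomial (Fin 4) k) (fun n => D (generator k n)) r
        ∈ idealI3 k := by
      have h3 := congrArg D hr
      rw [Fintype.linearCombination_apply, map_zero, map_sum] at h3
      simp only [smul_eq_mul, Derivation.leibniz, Finset.sum_add_distrib] at h3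
      rw [Fintype.linearCombination_apply]
      simp only [smul_eq_mul]
      rw [eq_neg_of_add_eq_zero_left h3]
      exact neg_mem (Ideal.sum_mem _ fun i _ =>
        Ideal.mul_mem_right _ _ ((standardGenerators k).gen_mem_ideal i))
    have h3 := sub_mem h1 h2
    rw [Fintype.linearCombination_apply, Fintype.linearCombination_apply,
      ← Finset.sum_sub_distrib] at h3
    simpa only [Fintype.linearCombination_apply, smul_sub] using h3
  · intro n p q i hn
    rw [map_sub, hH0 n p q i hn, hD, constDerivation_apply, map_sum, zero_sub, neg_eq_zero]
    refine Finset.sum_eq_zero fun u _ => ?_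
    rw [map_smul, toricCoeff_pderiv_eq_zero (generator_mem_stdGrading n) u hn, smul_zero]
  · intro p q i hpq
    rw [map_sub, hD, constDerivation_quadric]
    simp only [map_sub, map_add, map_smul, toricCoeff_mono, smul_eq_mul]
    by_cases hi : 1 < i
    · rw [toricCoeff_eq_zero_of_lt (by omega), if_neg (by omega), if_neg (by omega),
        if_neg (by omega), if_neg (by omega)]
      simp
    · obtain ⟨rfl, rfl⟩ | ⟨rfl, rfl⟩ : p = 0 ∧ q = 1 ∨ p = 1 ∧ q = 0 := by omega
      · obtain rfl | rfl : i = 0 ∨ i = 1 := by omega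
        all_goals simp
      · obtain rfl | rfl : i = 0 ∨ i = 1 := by omega
        all_goals simp

/-! ### Coefficients and the syzygies of degree four -/

/-- The exponent of `xᵃ yᵇ zᶜ wᵈ`. -/
def quadruple (a b c d : ℕ) : Fin 4 →₀ ℕ :=
  Finsupp.single 0 a + Finsupp.single 1 b + Finsupp.single 2 c + Finsupp.single 3 d

theorem quadruple_inj {a b c d a' b' c' d' : ℕ} :
    quadruple a b c d = quadruple a' b' c' d' ↔ a = a' ∧ b = b' ∧ c = c' ∧ d = d' := by
  refine ⟨fun h => ⟨?_, ?_, ?_, ?_⟩, by rintro ⟨rfl, rfl, rfl, rfl⟩; rfl⟩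
  · simpa [quadruple] using DFunLike.congr_fun h 0
  · simpa [quadruple] using DFunLike.congr_fun h 1
  · simpa [quadruple] using DFunLike.congr_fun h 2
  · simpa [quadruple] using DFunLike.congr_fun h 3

theorem mono_eq_monomial (a b c d : ℕ) : mono k a b c d = monomial (quadruple a b c d) 1 := by
  simp only [mono, X_pow_eq_monomial, monomial_mul, mul_one, quadruple]

/-- The coefficient of `xᵃ yᵇ zᶜ wᵈ`. -/
def monoCoeff (k : Type*) [Field k] (a b c d : ℕ) : MvPolynomial (Fin 4) k →ₗ[k] k :=
  lcoeff k (quadruple a b c d)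

theorem monoCoeff_mono (a b c d a' b' c' d' : ℕ) :
    monoCoeff k a b c d (mono k a' b' c' d') =
      if a' = a ∧ b' = b ∧ c' = c ∧ d' = d then 1 else 0 := by
  rw [mono_eq_monomial, monoCoeff, lcoeff_apply, coeff_monomial]
  simp only [quadruple_inj]

theorem monoCoeff_mono_mul (a b c d a' b' c' d' : ℕ) (f : MvPolynomial (Fin 4) k) :
    monoCoeff k a b c d (mono k a' b' c' d' * f) =
      if a' ≤ a ∧ b' ≤ b ∧ c' ≤ c ∧ d' ≤ d then
        monoCoeff k (a - a') (b - b') (c - c') (d - d') f else 0 := by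
  induction f using induction_on_mono with
  | add f g hf hg =>
    rw [mul_add, map_add, hf, hg]
    split_ifs <;> simp
  | smul_mono r a'' b'' c'' d'' =>
    rw [mul_smul_comm, map_smul, mono_mul_mono, map_smul, monoCoeff_mono, monoCoeff_mono]
    have : a' + a'' = a ∧ b' + b'' = b ∧ c' + c'' = c ∧ d' + d'' = d ↔
      (a' ≤ a ∧ b' ≤ b ∧ c' ≤ c ∧ d' ≤ d) ∧
        (a'' = a - a' ∧ b'' = b - b' ∧ c'' = c - c' ∧ d'' = d - d') := by
      omega
    simp only [this]
    split_ifs <;> simp_all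

@[elab_as_elim]
theorem stdGrading_induction {m : ℤ} {motive : MvPolynomial (Fin 4) k → Prop}
    {f : MvPolynomial (Fin 4) k} (hf : f ∈ stdGrading k m) (zero : motive 0)
    (add : ∀ f g, motive f → motive g → motive (f + g))
    (smul_mono : ∀ (r : k) (a b c d : ℕ), (a + b + c + d : ℤ) = m → motive (r • mono k a b c d)) :
    motive f := by
  rw [← hf.weightedHomogeneousComponent_same]
  clear hf
  induction f using induction_on_mono with
  | add f g hf hg => rw [map_add]; exact add _ _ hf hg
  | smul_mono r a b c d =>
    rw [map_smul, weightedHomogeneousComponent_of_mem (mono_mem_stdGrading a b c d)]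
    split_ifs with hm
    · exact smul_mono r a b c d (by omega)
    · rwa [smul_zero]

/-- Expansion of a form of degree at most zero (it is zero in negative degrees). -/
theorem eq_of_mem_stdGrading_le_zero {m : ℤ} (hm : m ≤ 0) {f : MvPolynomial (Fin 4) k}
    (hf : f ∈ stdGrading k m) : f = monoCoeff k 0 0 0 0 f • mono k 0 0 0 0 := by
  refine stdGrading_induction hf (by simp) (fun f g hf hg => ?_) (fun r a b c d h => ?_)
  · rw [map_add, add_smul, ← hf, ← hg]
  · obtain ⟨rfl, rfl, rfl, rfl⟩ : a = 0 ∧ b = 0 ∧ c = 0 ∧ d = 0 := by omega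
    simp [monoCoeff_mono]

/-- Expansion of a form of degree at most one. -/
theorem eq_of_mem_stdGrading_le_one {m : ℤ} (hm : m ≤ 1) {f : MvPolynomial (Fin 4) k}
    (hf : f ∈ stdGrading k m) :
    f = monoCoeff k 0 0 0 0 f • mono k 0 0 0 0 + monoCoeff k 1 0 0 0 f • mono k 1 0 0 0 +
      monoCoeff k 0 1 0 0 f • mono k 0 1 0 0 + monoCoeff k 0 0 1 0 f • mono k 0 0 1 0 +
      monoCoeff k 0 0 0 1 f • mono k 0 0 0 1 := by
  refine stdGrading_induction hf (by simp) (fun f g hf hg => ?_) (fun r a b c d h => ?_)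
  · conv_lhs => rw [hf, hg]
    simp only [map_add, add_smul]
    abel
  · obtain ⟨rfl, rfl, rfl, rfl⟩ | ⟨rfl, rfl, rfl, rfl⟩ | ⟨rfl, rfl, rfl, rfl⟩ |
      ⟨rfl, rfl, rfl, rfl⟩ | ⟨rfl, rfl, rfl, rfl⟩ : (a = 0 ∧ b = 0 ∧ c = 0 ∧ d = 0) ∨
      (a = 1 ∧ b = 0 ∧ c = 0 ∧ d = 0) ∨ (a = 0 ∧ b = 1 ∧ c = 0 ∧ d = 0) ∨
      (a = 0 ∧ b = 0 ∧ c = 1 ∧ d = 0) ∨ (a = 0 ∧ b = 0 ∧ c = 0 ∧ d = 1) := by omega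
    all_goals simp [monoCoeff_mono]

/-- Expansion of a form of degree at most two. -/
theorem eq_of_mem_stdGrading_le_two {m : ℤ} (hm : m ≤ 2) {f : MvPolynomial (Fin 4) k}
    (hf : f ∈ stdGrading k m) :
    f = monoCoeff k 0 0 0 0 f • mono k 0 0 0 0 + monoCoeff k 1 0 0 0 f • mono k 1 0 0 0 +
      monoCoeff k 0 1 0 0 f • mono k 0 1 0 0 + monoCoeff k 0 0 1 0 f • mono k 0 0 1 0 +
      monoCoeff k 0 0 0 1 f • mono k 0 0 0 1 +
      monoCoeff k 2 0 0 0 f • mono k 2 0 0 0 + monoCoeff k 1 1 0 0 f • mono k 1 1 0 0 +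
      monoCoeff k 0 2 0 0 f • mono k 0 2 0 0 + monoCoeff k 0 0 2 0 f • mono k 0 0 2 0 +
      monoCoeff k 0 0 1 1 f • mono k 0 0 1 1 + monoCoeff k 0 0 0 2 f • mono k 0 0 0 2 +
      monoCoeff k 1 0 1 0 f • mono k 1 0 1 0 + monoCoeff k 1 0 0 1 f • mono k 1 0 0 1 +
      monoCoeff k 0 1 1 0 f • mono k 0 1 1 0 + monoCoeff k 0 1 0 1 f • mono k 0 1 0 1 := by
  refine stdGrading_induction hf (by simp) (fun f g hf hg => ?_) (fun r a b c d h => ?_)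
  · conv_lhs => rw [hf, hg]
    simp only [map_add, add_smul]
    abel
  · obtain ha : a ≤ 2 := by omega
    obtain hb : b ≤ 2 := by omega
    obtain hc : c ≤ 2 := by omega
    interval_cases a <;> interval_cases b <;> first | omega | skip
    all_goals interval_cases c <;> first | omega | skip
    all_goals
      have hd : d ≤ 2 := by omega
      interval_cases d <;> first | omega | simp [monoCoeff_mono]

/-- The multiple `a e_i` of a basis vector of the free module on the twelve generators. -/
def basisVector (i : Fin 12) (a : MvPolynomial (Fin 4) k) : Fin 12 → MvPolynomial (Fin 4) k :=
  Pi.single i a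

/-- Twelve relations of degree four between the generators: `x e₁ - y e₀`, `x² e₈ - z e₀ + w e₁` and
their analogues. -/
def syzygy (k : Type*) [Field k] : Fin 12 → Fin 12 → MvPolynomial (Fin 4) k :=
  ![basisVector 1 (X 0) - basisVector 0 (X 1),
    basisVector 2 (X 0) - basisVector 1 (X 1),
    basisVector 3 (X 0) - basisVector 2 (X 1),
    basisVector 8 (mono k 2 0 0 0) - basisVector 0 (X 2) + basisVector 1 (X 3),
    basisVector 8 (mono k 1 1 0 0) - basisVector 1 (X 2) + basisVector 2 (X 3),
    basisVector 8 (mono k 0 2 0 0) - basisVector 2 (X 2) + basisVector 3 (X 3),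
    basisVector 5 (X 2) - basisVector 4 (X 3),
    basisVector 6 (X 2) - basisVector 5 (X 3),
    basisVector 7 (X 2) - basisVector 6 (X 3),
    basisVector 8 (mono k 0 0 2 0) - basisVector 4 (X 0) + basisVector 5 (X 1),
    basisVector 8 (mono k 0 0 1 1) - basisVector 5 (X 0) + basisVector 6 (X 1),
    basisVector 8 (mono k 0 0 0 2) - basisVector 6 (X 0) + basisVector 7 (X 1)]

theorem toIdeal_basisVector (i : Fin 12) (a : MvPolynomial (Fin 4) k) :
    (standardGenerators k).toIdeal (basisVector i a) = a * generator k i :=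
  Fintype.linearCombination_apply_single _ _ _ _

theorem syzygy_mem_relations (r : Fin 12) : syzygy k r ∈ (standardGenerators k).relations := by
  rw [HomogeneousGenerators.relations, LinearMap.mem_ker]
  fin_cases r <;> simp [syzygy, toIdeal_basisVector, generator] <;> simp [mono] <;> ring

/-! ### Relations in low degrees -/

/-- The coefficient of `xᵃ yᵇ zᶜ wᵈ` in a relation between the generators. -/
theorem sum_monoCoeff_eq_zero {v : Fin 12 → MvPolynomial (Fin 4) k}
    (hv : v ∈ (standardGenerators k).relations) (a b c d : ℕ) :
    monoCoeff k a b c d (mono k 3 0 0 0 * v 0) + monoCoeff k a b c d (mono k 2 1 0 0 * v 1) +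
      monoCoeff k a b c d (mono k 1 2 0 0 * v 2) + monoCoeff k a b c d (mono k 0 3 0 0 * v 3) +
      monoCoeff k a b c d (mono k 0 0 3 0 * v 4) + monoCoeff k a b c d (mono k 0 0 2 1 * v 5) +
      monoCoeff k a b c d (mono k 0 0 1 2 * v 6) + monoCoeff k a b c d (mono k 0 0 0 3 * v 7) +
      monoCoeff k a b c d (mono k 1 0 1 0 * v 8) - monoCoeff k a b c d (mono k 0 1 0 1 * v 8) +
      monoCoeff k a b c d (mono k 2 0 2 0 * v 9) + monoCoeff k a b c d (mono k 2 0 0 2 * v 10) +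
      monoCoeff k a b c d (mono k 0 2 2 0 * v 11) = 0 := by
  have h : (standardGenerators k).toIdeal v = 0 := hv
  have hsum : (standardGenerators k).toIdeal v = mono k 3 0 0 0 * v 0 + mono k 2 1 0 0 * v 1 +
      mono k 1 2 0 0 * v 2 + mono k 0 3 0 0 * v 3 + mono k 0 0 3 0 * v 4 + mono k 0 0 2 1 * v 5 +
      mono k 0 0 1 2 * v 6 + mono k 0 0 0 3 * v 7 + mono k 1 0 1 0 * v 8 - mono k 0 1 0 1 * v 8 +
      mono k 2 0 2 0 * v 9 + mono k 2 0 0 2 * v 10 + mono k 0 2 2 0 * v 11 := by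
    rw [HomogeneousGenerators.toIdeal_apply]
    simp only [Fin.sum_univ_succ, Fin.sum_univ_zero]
    have e (i : Fin 12) : (standardGenerators k).gen i = generator k i := rfl
    simp only [e]
    simp [generator]
    ring
  rw [hsum] at h
  simpa only [map_add, map_sub, map_zero] using congrArg (monoCoeff k a b c d) h

theorem sum_smul_syzygy (c : Fin 12 → k) : ∑ r, c r • syzygy k r =
    ![-(c 0 • mono k 0 1 0 0) + -(c 3 • mono k 0 0 1 0),
      c 0 • mono k 1 0 0 0 + -(c 1 • mono k 0 1 0 0) + -(c 4 • mono k 0 0 1 0) +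
        c 3 • mono k 0 0 0 1,
      c 1 • mono k 1 0 0 0 + -(c 2 • mono k 0 1 0 0) + -(c 5 • mono k 0 0 1 0) +
        c 4 • mono k 0 0 0 1,
      c 2 • mono k 1 0 0 0 + c 5 • mono k 0 0 0 1,
      -(c 9 • mono k 1 0 0 0) + -(c 6 • mono k 0 0 0 1),
      -(c 10 • mono k 1 0 0 0) + c 9 • mono k 0 1 0 0 + c 6 • mono k 0 0 1 0 +
        -(c 7 • mono k 0 0 0 1),
      -(c 11 • mono k 1 0 0 0) + c 10 • mono k 0 1 0 0 + c 7 • mono k 0 0 1 0 +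
        -(c 8 • mono k 0 0 0 1),
      c 11 • mono k 0 1 0 0 + c 8 • mono k 0 0 1 0,
      c 3 • mono k 2 0 0 0 + c 4 • mono k 1 1 0 0 + c 5 • mono k 0 2 0 0 + c 9 • mono k 0 0 2 0 +
        c 10 • mono k 0 0 1 1 + c 11 • mono k 0 0 0 2,
      0, 0, 0] := by
  simp only [Fin.sum_univ_succ, Fin.sum_univ_zero]
  funext i
  fin_cases i <;>
    simp [syzygy, basisVector, X_zero_eq_mono, X_one_eq_mono, X_two_eq_mono,
      X_three_eq_mono] <;> abel

/-- In degrees at most four, the relations between the generators are the combinations of the twelve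
syzygies. -/
theorem mem_span_syzygy {v : Fin 12 → MvPolynomial (Fin 4) k}
    (hv : v ∈ (standardGenerators k).relations) {m : ℤ} (hm : m ≤ 4)
    (hvm : v ∈ (standardGenerators k).freePiece m) :
    v ∈ Submodule.span (MvPolynomial (Fin 4) k) (Set.range (syzygy k)) := by
  -- comparing coefficients, all coefficients of `v` are expressed by twelve of them
  have E := sum_monoCoeff_eq_zero hv
  simp only [monoCoeff_mono_mul] at E
  have e0_0000 : monoCoeff k 0 0 0 0 (v 0) = 0 := by simpa using E 3 0 0 0
  have e0_0001 : monoCoeff k 0 0 0 1 (v 0) = 0 := by simpa using E 3 0 0 1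
  have e0_0010 : monoCoeff k 0 0 1 0 (v 0) = -monoCoeff k 2 0 0 0 (v 8) := by
    simpa [add_eq_zero_iff_eq_neg] using E 3 0 1 0
  have e0_0100 : monoCoeff k 0 1 0 0 (v 0) = -monoCoeff k 1 0 0 0 (v 1) := by
    simpa [add_eq_zero_iff_eq_neg] using E 3 1 0 0
  have e0_1000 : monoCoeff k 1 0 0 0 (v 0) = 0 := by simpa using E 4 0 0 0
  have e1_0000 : monoCoeff k 0 0 0 0 (v 1) = 0 := by simpa using E 2 1 0 0
  have e1_0001 : monoCoeff k 0 0 0 1 (v 1) = monoCoeff k 2 0 0 0 (v 8) := by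
    simpa [sub_eq_zero] using E 2 1 0 1
  have e1_0010 : monoCoeff k 0 0 1 0 (v 1) = -monoCoeff k 1 1 0 0 (v 8) := by
    simpa [add_eq_zero_iff_eq_neg] using E 2 1 1 0
  have e1_0100 : monoCoeff k 0 1 0 0 (v 1) = -monoCoeff k 1 0 0 0 (v 2) := by
    simpa [add_eq_zero_iff_eq_neg] using E 2 2 0 0
  have e2_0000 : monoCoeff k 0 0 0 0 (v 2) = 0 := by simpa using E 1 2 0 0
  have e2_0001 : monoCoeff k 0 0 0 1 (v 2) = monoCoeff k 1 1 0 0 (v 8) := by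
    simpa [sub_eq_zero] using E 1 2 0 1
  have e2_0010 : monoCoeff k 0 0 1 0 (v 2) = -monoCoeff k 0 2 0 0 (v 8) := by
    simpa [add_eq_zero_iff_eq_neg] using E 1 2 1 0
  have e2_0100 : monoCoeff k 0 1 0 0 (v 2) = -monoCoeff k 1 0 0 0 (v 3) := by
    simpa [add_eq_zero_iff_eq_neg] using E 1 3 0 0
  have e3_0000 : monoCoeff k 0 0 0 0 (v 3) = 0 := by simpa using E 0 3 0 0
  have e3_0001 : monoCoeff k 0 0 0 1 (v 3) = monoCoeff k 0 2 0 0 (v 8) := by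
    simpa [sub_eq_zero] using E 0 3 0 1
  have e3_0010 : monoCoeff k 0 0 1 0 (v 3) = 0 := by simpa using E 0 3 1 0
  have e3_0100 : monoCoeff k 0 1 0 0 (v 3) = 0 := by simpa using E 0 4 0 0
  have e4_0000 : monoCoeff k 0 0 0 0 (v 4) = 0 := by simpa using E 0 0 3 0
  have e4_0001 : monoCoeff k 0 0 0 1 (v 4) = -monoCoeff k 0 0 1 0 (v 5) := by
    simpa [add_eq_zero_iff_eq_neg] using E 0 0 3 1
  have e4_0010 : monoCoeff k 0 0 1 0 (v 4) = 0 := by simpa using E 0 0 4 0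
  have e4_0100 : monoCoeff k 0 1 0 0 (v 4) = 0 := by simpa using E 0 1 3 0
  have e4_1000 : monoCoeff k 1 0 0 0 (v 4) = -monoCoeff k 0 0 2 0 (v 8) := by
    simpa [add_eq_zero_iff_eq_neg] using E 1 0 3 0
  have e5_0000 : monoCoeff k 0 0 0 0 (v 5) = 0 := by simpa using E 0 0 2 1
  have e5_0001 : monoCoeff k 0 0 0 1 (v 5) = -monoCoeff k 0 0 1 0 (v 6) := by
    simpa [add_eq_zero_iff_eq_neg] using E 0 0 2 2
  have e5_0100 : monoCoeff k 0 1 0 0 (v 5) = monoCoeff k 0 0 2 0 (v 8) := by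
    simpa [sub_eq_zero] using E 0 1 2 1
  have e5_1000 : monoCoeff k 1 0 0 0 (v 5) = -monoCoeff k 0 0 1 1 (v 8) := by
    simpa [add_eq_zero_iff_eq_neg] using E 1 0 2 1
  have e6_0000 : monoCoeff k 0 0 0 0 (v 6) = 0 := by simpa using E 0 0 1 2
  have e6_0001 : monoCoeff k 0 0 0 1 (v 6) = -monoCoeff k 0 0 1 0 (v 7) := by
    simpa [add_eq_zero_iff_eq_neg] using E 0 0 1 3
  have e6_0100 : monoCoeff k 0 1 0 0 (v 6) = monoCoeff k 0 0 1 1 (v 8) := by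
    simpa [sub_eq_zero] using E 0 1 1 2
  have e6_1000 : monoCoeff k 1 0 0 0 (v 6) = -monoCoeff k 0 0 0 2 (v 8) := by
    simpa [add_eq_zero_iff_eq_neg] using E 1 0 1 2
  have e7_0000 : monoCoeff k 0 0 0 0 (v 7) = 0 := by simpa using E 0 0 0 3
  have e7_0001 : monoCoeff k 0 0 0 1 (v 7) = 0 := by simpa using E 0 0 0 4
  have e7_0100 : monoCoeff k 0 1 0 0 (v 7) = monoCoeff k 0 0 0 2 (v 8) := by
    simpa [sub_eq_zero] using E 0 1 0 3
  have e7_1000 : monoCoeff k 1 0 0 0 (v 7) = 0 := by simpa using E 1 0 0 3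
  have e8_0000 : monoCoeff k 0 0 0 0 (v 8) = 0 := by simpa using E 0 1 0 1
  have e8_0001 : monoCoeff k 0 0 0 1 (v 8) = 0 := by simpa using E 0 1 0 2
  have e8_0010 : monoCoeff k 0 0 1 0 (v 8) = 0 := by simpa using E 0 1 1 1
  have e8_0100 : monoCoeff k 0 1 0 0 (v 8) = 0 := by simpa using E 0 2 0 1
  have e8_1000 : monoCoeff k 1 0 0 0 (v 8) = 0 := by simpa using E 1 1 0 1
  have e8_0101 : monoCoeff k 0 1 0 1 (v 8) = 0 := by simpa using E 0 2 0 2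
  have e8_0110 : monoCoeff k 0 1 1 0 (v 8) = 0 := by simpa using E 0 2 1 1
  have e8_1001 : monoCoeff k 1 0 0 1 (v 8) = 0 := by simpa using E 1 1 0 2
  have e8_1010 : monoCoeff k 1 0 1 0 (v 8) = 0 := by simpa [e8_0101] using E 1 1 1 1
  have e9_0000 : monoCoeff k 0 0 0 0 (v 9) = 0 := by
    simpa [e8_1010] using E 2 0 2 0
  have e10_0000 : monoCoeff k 0 0 0 0 (v 10) = 0 := by simpa using E 2 0 0 2
  have e11_0000 : monoCoeff k 0 0 0 0 (v 11) = 0 := by simpa using E 0 2 2 0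
  have h0 := eq_of_mem_stdGrading_le_one (show m - 3 ≤ 1 by omega) (hvm 0)
  simp only [e0_0000, e0_0001, e0_0010, e0_0100, e0_1000, zero_smul, zero_add, add_zero,
    neg_smul] at h0
  have h1 := eq_of_mem_stdGrading_le_one (show m - 3 ≤ 1 by omega) (hvm 1)
  simp only [e1_0000, e1_0001, e1_0010, e1_0100, zero_smul, zero_add, neg_smul] at h1
  have h2 := eq_of_mem_stdGrading_le_one (show m - 3 ≤ 1 by omega) (hvm 2)
  simp only [e2_0000, e2_0001, e2_0010, e2_0100, zero_smul, zero_add, neg_smul] at h2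
  have h3 := eq_of_mem_stdGrading_le_one (show m - 3 ≤ 1 by omega) (hvm 3)
  simp only [e3_0000, e3_0001, e3_0010, e3_0100, zero_smul, zero_add, add_zero] at h3
  have h4 := eq_of_mem_stdGrading_le_one (show m - 3 ≤ 1 by omega) (hvm 4)
  simp only [e4_0000, e4_0001, e4_0010, e4_0100, e4_1000, zero_smul, zero_add, add_zero,
    neg_smul] at h4
  have h5 := eq_of_mem_stdGrading_le_one (show m - 3 ≤ 1 by omega) (hvm 5)
  simp only [e5_0000, e5_0001, e5_0100, e5_1000, zero_smul, zero_add, neg_smul] at h5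
  have h6 := eq_of_mem_stdGrading_le_one (show m - 3 ≤ 1 by omega) (hvm 6)
  simp only [e6_0000, e6_0001, e6_0100, e6_1000, zero_smul, zero_add, neg_smul] at h6
  have h7 := eq_of_mem_stdGrading_le_one (show m - 3 ≤ 1 by omega) (hvm 7)
  simp only [e7_0000, e7_0001, e7_0100, e7_1000, zero_smul, zero_add, add_zero] at h7
  have h8 := eq_of_mem_stdGrading_le_two (show m - 2 ≤ 2 by omega) (hvm 8)
  simp only [e8_0000, e8_0001, e8_0010, e8_0100, e8_1000, e8_0101, e8_0110,
     e8_1001, e8_1010, zero_smul, zero_add, add_zero] at h8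
  have h9 := eq_of_mem_stdGrading_le_zero (show m - 4 ≤ 0 by omega) (hvm 9)
  simp only [e9_0000, zero_smul] at h9
  have h10 := eq_of_mem_stdGrading_le_zero (show m - 4 ≤ 0 by omega) (hvm 10)
  simp only [e10_0000, zero_smul] at h10
  have h11 := eq_of_mem_stdGrading_le_zero (show m - 4 ≤ 0 by omega) (hvm 11)
  simp only [e11_0000, zero_smul] at h11
  have hcomb : v = ∑ r, (![
    monoCoeff k 1 0 0 0 (v 1), monoCoeff k 1 0 0 0 (v 2), monoCoeff k 1 0 0 0 (v 3),
    monoCoeff k 2 0 0 0 (v 8), monoCoeff k 1 1 0 0 (v 8), monoCoeff k 0 2 0 0 (v 8),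
    monoCoeff k 0 0 1 0 (v 5), monoCoeff k 0 0 1 0 (v 6), monoCoeff k 0 0 1 0 (v 7),
    monoCoeff k 0 0 2 0 (v 8), monoCoeff k 0 0 1 1 (v 8), monoCoeff k 0 0 0 2 (v 8)] :
      Fin 12 → k) r • syzygy k r := by
    rw [sum_smul_syzygy]
    funext i
    fin_cases i
    exacts [h0, h1, h2, h3, h4, h5, h6, h7, h8, h9, h10, h11]
  rw [hcomb]
  exact Submodule.sum_mem _ fun r _ =>
    Submodule.smul_of_tower_mem _ _ (Submodule.subset_span ⟨r, rfl⟩)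

/-! ### Obstructions of nonnegative degree -/

/-- In `S / idealI3`, an element without terms of degree less than four is determined by its
coefficients at `a²b²s` and `a²b²s³`. -/
theorem sub_mem_idealI3_of_top {f T : MvPolynomial (Fin 4) k}
    (hf : ∀ p q i, p + q < 4 → toricCoeff k p q i f = 0)
    (hT : ∀ p q i, p + q < 4 → toricCoeff k p q i T = 0)
    (h1 : toricCoeff k 2 2 1 f = toricCoeff k 2 2 1 T)
    (h3 : toricCoeff k 2 2 3 f = toricCoeff k 2 2 3 T) : f - T ∈ idealI3 k := by
  rw [mem_idealI3_iff]
  intro p q i h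
  rw [map_sub, sub_eq_zero]
  by_cases hpq : p + q < 4
  · rw [hf p q i hpq, hT p q i hpq]
  by_cases hi : 4 < i
  · rw [toricCoeff_eq_zero_of_lt (by unfold supportI3 at h; omega),
      toricCoeff_eq_zero_of_lt (by unfold supportI3 at h; omega)]
  unfold supportI3 at h
  obtain ⟨rfl, rfl, rfl | rfl⟩ : p = 2 ∧ q = 2 ∧ (i = 1 ∨ i = 3) := by omega
  exacts [h1, h3]

/-- For `T`, `T'` of top degree there is a cubic `U` with `y U = T`, `z U = T'` and `x U = w U = 0`
in `S / idealI3`. -/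
theorem exists_top_xy {T T' : MvPolynomial (Fin 4) k}
    (hT : ∀ p q i, p + q < 4 → toricCoeff k p q i T = 0)
    (hT' : ∀ p q i, p + q < 4 → toricCoeff k p q i T' = 0) :
    ∃ U ∈ stdGrading k 3, X 0 * U ∈ idealI3 k ∧ X 1 * U - T ∈ idealI3 k ∧
      X 2 * U - T' ∈ idealI3 k ∧ X 3 * U ∈ idealI3 k := by
  have h0 (p q i : ℕ) (_ : p + q < 4) : toricCoeff k p q i (0 : MvPolynomial (Fin 4) k) = 0 :=
    map_zero _
  -- `x w²` and `x z²` are `a b² s³` and `a b² s`: multiplied by `y`, they give `a²b²s³` and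
  -- `a²b²s`, multiplied by `x`, they give `a²b²s⁴` and `a²b²s²`, which vanish. Likewise for `x²w`
  -- and `xyz` with `z` and `w`.
  refine ⟨toricCoeff k 2 2 3 T • mono k 1 0 0 2 + toricCoeff k 2 2 1 T • mono k 1 0 2 0 +
    toricCoeff k 2 2 3 T' • mono k 2 0 0 1 + toricCoeff k 2 2 1 T' • mono k 1 1 1 0, ?_, ?_, ?_,
    ?_, ?_⟩
  · exact add_mem (add_mem (add_mem (Submodule.smul_mem _ _ (mono_mem_stdGrading 1 0 0 2))
      (Submodule.smul_mem _ _ (mono_mem_stdGrading 1 0 2 0)))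
      (Submodule.smul_mem _ _ (mono_mem_stdGrading 2 0 0 1)))
      (Submodule.smul_mem _ _ (mono_mem_stdGrading 1 1 1 0))
  · rw [← sub_zero (X 0 * _), X_zero_eq_mono]
    refine sub_mem_idealI3_of_top (fun p q i h => ?_) h0
      (by simp [mul_add, mono_mul_mono, toricCoeff_mono])
      (by simp [mul_add, mono_mul_mono, toricCoeff_mono])
    simp [mul_add, mono_mul_mono, toricCoeff_mono]
    grind
  · rw [X_one_eq_mono]
    refine sub_mem_idealI3_of_top (fun p q i h => ?_) hT
      (by simp [mul_add, mono_mul_mono, toricCoeff_mono])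
      (by simp [mul_add, mono_mul_mono, toricCoeff_mono])
    simp [mul_add, mono_mul_mono, toricCoeff_mono]
    grind
  · rw [X_two_eq_mono]
    refine sub_mem_idealI3_of_top (fun p q i h => ?_) hT'
      (by simp [mul_add, mono_mul_mono, toricCoeff_mono])
      (by simp [mul_add, mono_mul_mono, toricCoeff_mono])
    simp [mul_add, mono_mul_mono, toricCoeff_mono]
    grind
  · rw [← sub_zero (X 3 * _), X_three_eq_mono]
    refine sub_mem_idealI3_of_top (fun p q i h => ?_) h0
      (by simp [mul_add, mono_mul_mono, toricCoeff_mono])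
      (by simp [mul_add, mono_mul_mono, toricCoeff_mono])
    simp [mul_add, mono_mul_mono, toricCoeff_mono]
    grind

/-- For `T`, `T'` of top degree there is a cubic `U` with `w U = T`, `x U = T'` and `y U = z U = 0`
in `S / idealI3`. -/
theorem exists_top_zw {T T' : MvPolynomial (Fin 4) k}
    (hT : ∀ p q i, p + q < 4 → toricCoeff k p q i T = 0)
    (hT' : ∀ p q i, p + q < 4 → toricCoeff k p q i T' = 0) :
    ∃ U ∈ stdGrading k 3, X 2 * U ∈ idealI3 k ∧ X 3 * U - T ∈ idealI3 k ∧
      X 0 * U - T' ∈ idealI3 k ∧ X 1 * U ∈ idealI3 k := by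
  have h0 (p q i : ℕ) (_ : p + q < 4) : toricCoeff k p q i (0 : MvPolynomial (Fin 4) k) = 0 :=
    map_zero _
  -- `x²z` and `y²z` are `a² b s²` and `a² b`: multiplied by `w`, they give `a²b²s³` and `a²b²s`,
  -- multiplied by `z`, they give `a²b²s²` and `a²b²`, which vanish. Likewise for `xzw` and `yz²`
  -- with `x` and `y`.
  refine ⟨toricCoeff k 2 2 3 T • mono k 2 0 1 0 + toricCoeff k 2 2 1 T • mono k 0 2 1 0 +
    toricCoeff k 2 2 3 T' • mono k 1 0 1 1 + toricCoeff k 2 2 1 T' • mono k 0 1 2 0, ?_, ?_, ?_,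
    ?_, ?_⟩
  · exact add_mem (add_mem (add_mem (Submodule.smul_mem _ _ (mono_mem_stdGrading 2 0 1 0))
      (Submodule.smul_mem _ _ (mono_mem_stdGrading 0 2 1 0)))
      (Submodule.smul_mem _ _ (mono_mem_stdGrading 1 0 1 1)))
      (Submodule.smul_mem _ _ (mono_mem_stdGrading 0 1 2 0))
  · rw [← sub_zero (X 2 * _), X_two_eq_mono]
    refine sub_mem_idealI3_of_top (fun p q i h => ?_) h0
      (by simp [mul_add, mono_mul_mono, toricCoeff_mono])
      (by simp [mul_add, mono_mul_mono, toricCoeff_mono])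
    simp [mul_add, mono_mul_mono, toricCoeff_mono]
    grind
  · rw [X_three_eq_mono]
    refine sub_mem_idealI3_of_top (fun p q i h => ?_) hT
      (by simp [mul_add, mono_mul_mono, toricCoeff_mono])
      (by simp [mul_add, mono_mul_mono, toricCoeff_mono])
    simp [mul_add, mono_mul_mono, toricCoeff_mono]
    grind
  · rw [X_zero_eq_mono]
    refine sub_mem_idealI3_of_top (fun p q i h => ?_) hT'
      (by simp [mul_add, mono_mul_mono, toricCoeff_mono])
      (by simp [mul_add, mono_mul_mono, toricCoeff_mono])
    simp [mul_add, mono_mul_mono, toricCoeff_mono]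
    grind
  · rw [← sub_zero (X 1 * _), X_one_eq_mono]
    refine sub_mem_idealI3_of_top (fun p q i h => ?_) h0
      (by simp [mul_add, mono_mul_mono, toricCoeff_mono])
      (by simp [mul_add, mono_mul_mono, toricCoeff_mono])
    simp [mul_add, mono_mul_mono, toricCoeff_mono]
    grind

theorem syzygy_mem_freePiece (r : Fin 12) : syzygy k r ∈ (standardGenerators k).freePiece 4 := by
  have hs {i : Fin 12} {a : MvPolynomial (Fin 4) k}
      (ha : a ∈ stdGrading k (4 - generatorDegree i)) :
      basisVector i a ∈ (standardGenerators k).freePiece 4 := by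
    intro l
    rcases eq_or_ne l i with rfl | hl
    · rw [basisVector, Pi.single_eq_same]
      exact ha
    · simp [basisVector, hl]
  have h0 : (X 0 : MvPolynomial (Fin 4) k) ∈ stdGrading k 1 := isWeightedHomogeneous_X k _ _
  have h1 : (X 1 : MvPolynomial (Fin 4) k) ∈ stdGrading k 1 := isWeightedHomogeneous_X k _ _
  have h2 : (X 2 : MvPolynomial (Fin 4) k) ∈ stdGrading k 1 := isWeightedHomogeneous_X k _ _
  have h3 : (X 3 : MvPolynomial (Fin 4) k) ∈ stdGrading k 1 := isWeightedHomogeneous_X k _ _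
  fin_cases r
  · exact sub_mem (hs h0) (hs h1)
  · exact sub_mem (hs h0) (hs h1)
  · exact sub_mem (hs h0) (hs h1)
  · exact add_mem (sub_mem (hs (mono_mem_stdGrading 2 0 0 0)) (hs h2)) (hs h3)
  · exact add_mem (sub_mem (hs (mono_mem_stdGrading 1 1 0 0)) (hs h2)) (hs h3)
  · exact add_mem (sub_mem (hs (mono_mem_stdGrading 0 2 0 0)) (hs h2)) (hs h3)
  · exact sub_mem (hs h2) (hs h3)
  · exact sub_mem (hs h2) (hs h3)
  · exact sub_mem (hs h2) (hs h3)
  · exact add_mem (sub_mem (hs (mono_mem_stdGrading 0 0 2 0)) (hs h0)) (hs h1)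
  · exact add_mem (sub_mem (hs (mono_mem_stdGrading 0 0 1 1)) (hs h0)) (hs h1)
  · exact add_mem (sub_mem (hs (mono_mem_stdGrading 0 0 0 2)) (hs h0)) (hs h1)

theorem mk_eq_zero_of_mem_stdGrading {m : ℤ} (hm : 5 ≤ m) {f : MvPolynomial (Fin 4) k}
    (hf : f ∈ stdGrading k m) : Ideal.Quotient.mk (idealI3 k) f = 0 := by
  rw [Ideal.Quotient.eq_zero_iff_mem, mem_idealI3_iff]
  intro p q i h
  unfold supportI3 at h
  exact toricCoeff_eq_zero_of_mem_stdGrading hf (by omega)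

/-- Prescribed values of top degree on the twelve syzygies are attained by a homogeneous map of the
free module. -/
theorem exists_linearCombination_syzygy (T : Fin 12 → MvPolynomial (Fin 4) k)
    (hT : ∀ r p q i, p + q < 4 → toricCoeff k p q i (T r) = 0) :
    ∃ U : Fin 12 → MvPolynomial (Fin 4) k, (∀ i, U i ∈ stdGrading k (generatorDegree i)) ∧
      ∀ r, Fintype.linearCombination (MvPolynomial (Fin 4) k) U (syzygy k r) - T r ∈ idealI3 k := by
  obtain ⟨U0, hU0, x0, y0, z0, w0⟩ := exists_top_xy (hT 0) (hT 3)
  obtain ⟨U1, hU1, x1, y1, z1, w1⟩ := exists_top_xy (hT 1) (hT 4)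
  obtain ⟨U2, hU2, x2, y2, z2, w2⟩ := exists_top_xy (hT 2) (hT 5)
  obtain ⟨U4, hU4, z4, w4, x4, y4⟩ := exists_top_zw (hT 6) (hT 9)
  obtain ⟨U5, hU5, z5, w5, x5, y5⟩ := exists_top_zw (hT 7) (hT 10)
  obtain ⟨U6, hU6, z6, w6, x6, y6⟩ := exists_top_zw (hT 8) (hT 11)
  refine ⟨![-U0, -U1, -U2, 0, -U4, -U5, -U6, 0, 0, 0, 0, 0], fun i => ?_, fun r => ?_⟩
  -- `U i` has to be minus a solution, since each prescribed value enters with a negative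
  -- coefficient: `-y e₀` in the first syzygy, `-z e₀` in the fourth, and so on
  · fin_cases i
    exacts [neg_mem hU0, neg_mem hU1, neg_mem hU2, zero_mem _, neg_mem hU4, neg_mem hU5,
      neg_mem hU6, zero_mem _, zero_mem _, zero_mem _, zero_mem _, zero_mem _]
  · have hb (U : Fin 12 → MvPolynomial (Fin 4) k) (i : Fin 12) (a : MvPolynomial (Fin 4) k) :
        Fintype.linearCombination (MvPolynomial (Fin 4) k) U (basisVector i a) = a * U i :=
      Fintype.linearCombination_apply_single _ _ _ _
    fin_cases r
    · convert add_mem (neg_mem x1) y0 using 1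
      simp [syzygy, hb]
      ring
    · convert add_mem (neg_mem x2) y1 using 1
      simp [syzygy, hb]
      ring
    · convert y2 using 1
      simp [syzygy, hb]
    · convert sub_mem z0 w1 using 1
      simp [syzygy, hb]
      ring
    · convert sub_mem z1 w2 using 1
      simp [syzygy, hb]
      ring
    · convert z2 using 1
      simp [syzygy, hb]
    · convert add_mem (neg_mem z5) w4 using 1
      simp [syzygy, hb]
      ring
    · convert add_mem (neg_mem z6) w5 using 1
      simp [syzygy, hb]
      ring
    · convert w6 using 1
      simp [syzygy, hb]
    · convert sub_mem x4 y5 using 1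
      simp [syzygy, hb]
      ring
    · convert sub_mem x5 y6 using 1
      simp [syzygy, hb]
      ring
    · convert x6 using 1
      simp [syzygy, hb]

theorem T2Piece_eq_bot_of_nonneg {ι : Type*} [Fintype ι]
    (P : HomogeneousGenerators (stdGrading k) (idealI3 k) ι) {j : ℤ} (hj : 0 ≤ j) :
    P.T2Piece j = ⊥ := by
  refine HomogeneousGenerators.T2Piece_eq_bot (standardGenerators k) P j fun φ hφ => ?_
  choose T hT hTφ using fun r => hφ 4 ⟨syzygy k r, syzygy_mem_relations r⟩ (syzygy_mem_freePiece r)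
  obtain ⟨U, hU, hUT⟩ := exists_linearCombination_syzygy T fun r p q i h =>
    toricCoeff_eq_zero_of_mem_stdGrading (hT r) (by omega)
  let ψ : (Fin 12 → MvPolynomial (Fin 4) k) →ₗ[MvPolynomial (Fin 4) k]
      MvPolynomial (Fin 4) k ⧸ idealI3 k :=
    (Ideal.Quotient.mkₐ (MvPolynomial (Fin 4) k) (idealI3 k)).toLinearMap.comp
      (Fintype.linearCombination (MvPolynomial (Fin 4) k) U)
  refine ⟨ψ, fun v => ?_⟩
  -- below degree five the syzygies span, from degree five on both maps vanish
  have hcomp (m : ℤ) (v : (standardGenerators k).relations)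
      (hv : (v : Fin 12 → _) ∈ (standardGenerators k).freePiece m) : φ v = ψ v := by
    rcases le_or_gt m 4 with hm | hm
    · have hle : Submodule.span _ (Set.range (syzygy k)) ≤
          (LinearMap.eqLocus φ (ψ.comp (standardGenerators k).relations.subtype)).map
            (standardGenerators k).relations.subtype := by
        rw [Submodule.span_le]
        rintro _ ⟨r, rfl⟩
        refine ⟨⟨syzygy k r, syzygy_mem_relations r⟩, ?_, rfl⟩
        change φ _ = ψ (syzygy k r)
        rw [← hTφ r]
        exact ((Ideal.Quotient.mk_eq_mk_iff_sub_mem _ _).mpr (hUT r)).symm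
      obtain ⟨w, hw, hwv⟩ := hle (mem_span_syzygy v.2 hm hv)
      obtain rfl : w = v := Subtype.ext hwv
      exact hw
    · obtain ⟨f, hf, hfv⟩ := hφ m v hv
      have h1 : φ v = 0 := by
        rw [← hfv]
        exact mk_eq_zero_of_mem_stdGrading (by omega) hf
      have h2 : ψ v = 0 := by
        refine mk_eq_zero_of_mem_stdGrading (m := m) (by omega) ?_
        rw [Fintype.linearCombination_apply]
        refine Submodule.sum_mem _ fun i _ => ?_
        have h := SetLike.mul_mem_graded (hv i) (hU i)
        rwa [show m - (standardGenerators k).deg i + generatorDegree i = m from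
          sub_add_cancel _ _] at h
      rw [h1, h2]
  obtain ⟨s, hs⟩ := (standardGenerators k).exists_eq_sum_component v
  have hrel (m : ℤ) : (standardGenerators k).component m v ∈ (standardGenerators k).relations := by
    have h0 : (standardGenerators k).toIdeal v = 0 := v.2
    change (standardGenerators k).toIdeal _ = 0
    rw [HomogeneousGenerators.toIdeal_component, h0]
    simp
  have hv : v = ∑ m ∈ s, ⟨(standardGenerators k).component m v, hrel m⟩ := Subtype.ext (by
    rw [AddSubmonoidClass.coe_finsetSum]
    exact hs)
  conv_rhs => rw [hs]
  conv_lhs => rw [hv]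
  rw [map_sum, map_sum]
  exact Finset.sum_congr rfl fun m _ =>
    hcomp m _ ((standardGenerators k).component_mem m v)

end SmallElementary

end

theorem mainTheorem4 (k : Type*) [Field k] [IsAlgClosed k] [CharZero k] :
    -- the algebra `A = k[x,y,z,w] / I`
    (IsArtinianRing (MvPolynomial (Fin 4) k ⧸ SmallElementary.idealI k) ∧
      ∃ _ : IsLocalRing (MvPolynomial (Fin 4) k ⧸ SmallElementary.idealI k),
        SmallElementary.socle (MvPolynomial (Fin 4) k ⧸ SmallElementary.idealI k) =
          (Ideal.span {MvPolynomial.X 0 ^ 2 * MvPolynomial.X 2 ^ 2,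
            MvPolynomial.X 0 ^ 2 * MvPolynomial.X 2 * MvPolynomial.X 3,
            MvPolynomial.X 0 ^ 2 * MvPolynomial.X 3 ^ 2,
            MvPolynomial.X 0 * MvPolynomial.X 1 * MvPolynomial.X 2 ^ 2,
            MvPolynomial.X 1 ^ 2 * MvPolynomial.X 2 ^ 2}).map
              (Ideal.Quotient.mk (SmallElementary.idealI k)) ∧
        Module.finrank k
          (SmallElementary.socle (MvPolynomial (Fin 4) k ⧸ SmallElementary.idealI k)) = 5) ∧
    -- the algebra `k[x,y,z,w] / I3`
    (IsArtinianRing (MvPolynomial (Fin 4) k ⧸ SmallElementary.idealI3 k) ∧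
      ∃ _ : IsLocalRing (MvPolynomial (Fin 4) k ⧸ SmallElementary.idealI3 k),
        SmallElementary.socle (MvPolynomial (Fin 4) k ⧸ SmallElementary.idealI3 k) =
          (Ideal.span {MvPolynomial.X 0 ^ 2 * MvPolynomial.X 2 * MvPolynomial.X 3,
            MvPolynomial.X 0 * MvPolynomial.X 1 * MvPolynomial.X 2 ^ 2}).map
              (Ideal.Quotient.mk (SmallElementary.idealI3 k)) ∧
        Module.finrank k
          (SmallElementary.socle (MvPolynomial (Fin 4) k ⧸ SmallElementary.idealI3 k)) = 2) ∧
    -- its cotangent modules, computed with any finite family of homogeneous generators of `I3`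
    (∀ (ι : Type*) [Fintype ι]
      (P : SmallElementary.HomogeneousGenerators (SmallElementary.stdGrading k)
        (SmallElementary.idealI3 k) ι),
      (∀ j : ℤ, j < 0 → P.T1Piece j = ⊥) ∧ (∀ j : ℤ, 0 ≤ j → P.T2Piece j = ⊥)) := by
  refine ⟨⟨SmallElementary.isArtinianRing_quotient le_rfl, ?_⟩,
    ⟨SmallElementary.isArtinianRing_quotient SmallElementary.idealI_le_idealI3, ?_⟩, ?_⟩
  · have := SmallElementary.isLocalRing_quotient le_rfl (SmallElementary.idealI_ne_top (k := k))
    exact ⟨this, SmallElementary.socle_idealI⟩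
  · have := SmallElementary.isLocalRing_quotient SmallElementary.idealI_le_idealI3
      (SmallElementary.idealI3_ne_top (k := k))
    exact ⟨this, SmallElementary.socle_idealI3⟩
  · intro ι _ P
    exact ⟨fun j hj => SmallElementary.T1Piece_eq_bot_of_neg P hj,
      fun j hj => SmallElementary.T2Piece_eq_bot_of_nonneg P hj⟩
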